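/- Let $d\ge 3$ and let $\Omega\subset\mathbb{R}^d$ be open and bounded. For $\varepsilon>0$ let $\{K_i^\varepsilon\}_{i\in\Lambda^\varepsilon}$ be an at most countable family of subsets of $\mathbb{R}^d$. Throughout, limits are taken as $\varepsilon\to0^+$, the assumptions are required only for all sufficiently small $\varepsilon>0$, and "$i$", $\sum_i$, $\sup_i$ refer only to those $i\in\Lambda^\varepsilon$ with $\Omega\cap K_i^\varepsilon\ne\emptyset$. **Notation.** $|E|$ is Lebesgue measure and $B(x,r)$ is the open ball. For a compact $K\subset\mathbb{R}^d$, the capacity is $\mathrm{cap}(K)=\|\nabla H\|_{L^2(\mathbb{R}^d)}^2$, where $H$ is the continuous function with $H=1$ on $K$, $\Delta H=0$ on $\mathbb{R}^d\setminus K$ and $H(x)\to0$ as $|x|\to\infty$; if there is no such $H$, then $\mathrm{cap}(K)=\inf\{\|\nabla\varphi\|^2_{L^2(\mathbb{R}^d)}:\varphi\in C_c^\infty(\mathbb{R}^d),\ \varphi\ge1\text{ on }K\}$ (the two expressions agree when $H$ exists). $\mathcal{D}'(\Omega)$ is the space of distributions on $\Omega$, and $H^{-1}(\Omega)$ is the dual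 of $H_0^1(\Omega)$. **Assumptions.** Each $K_i^\varepsilon$ is compact, and $\overline{B(x_i^\varepsilon,a_{i\varepsilon})}$ is the minimal closed ball containing it. There are $R_{i\varepsilon}>0$ such that the balls $B(x_i^\varepsilon,R_{i\varepsilon})$ are pairwise disjoint, and Lebesgue measurable sets $A_i^\varepsilon\supset B(x_i^\varepsilon,R_{i\varepsilon})$, such that, the suprema over $\varepsilon$ being over all sufficiently small $\varepsilon>0$: 1. $\sup_{\varepsilon}\sup_i R_{i\varepsilon}<\infty$; 2. $\sup_{\varepsilon}\sup_i a_{i\varepsilon}/R_{i\varepsilon}<1$; 3. $\sum_i a_{i\varepsilon}^{2(d-2)}R_{i\varepsilon}^{-d+2}\to0$; 4. $\sup_{\varepsilon}\sup_i |A_i^\varepsilon|R_{i\varepsilon}^{-d}<\infty$; 5. $\sum_i a_{i\varepsilon}^{d-2}\operatorname{diam}A_i^\varepsilon\to0$ (with $0\cdot\infty=0$); 6. $\sum_i \frac{a_{i\varepsilon}^{d-2}}{|A_i^\varepsilon|}1_{A_i^\varepsilon}$ converges in the norm of $H^{-1}(\Omega)$; 7. $\sup_{\varepsilon}\sum_i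 a_{i\varepsilon}^{d-2}<\infty$; 8. $\sum_i\frac{\mathrm{cap}(K_i^\varepsilon)}{|A_i^\varepsilon|}1_{A_i^\varepsilon}\to\mu$ in $\mathcal{D}'(\Omega)$, for a distribution $\mu\in\mathcal{D}'(\Omega)$. **Conclusion.** Then $\mu\in H^{-1}(\Omega)$ and $$\Big\|\sum_i\frac{\mathrm{cap}(K_i^\varepsilon)}{|A_i^\varepsilon|}1_{A_i^\varepsilon}-\mu\Big\|_{H^{-1}(\Omega)}\to0.$$ If, in addition, $|K_i^\varepsilon|>0$ for all sufficiently small $\varepsilon$ and all $i$, then $$\sum_i\frac{\mathrm{cap}(K_i^\varepsilon)}{|K_i^\varepsilon|}1_{K_i^\varepsilon}\to\mu\quad\text{in }\mathcal{D}'(\Omega).$$ -/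

import Mathlib

open Filter Topology MeasureTheory Set
open scoped ENNReal ContDiff Distributions

noncomputable section

namespace Perforated

/-- The Euclidean space `ℝ^d`. -/
abbrev Space (d : ℕ) : Type := EuclideanSpace ℝ (Fin d)

/-! ### Newtonian capacity -/

/-- `H` is the (classical) capacitary potential of `K`: it is continuous, equal to `1` on `K`,
harmonic off `K`, and it vanishes at infinity. Such an `H` is unique if it exists. -/
structure IsCapacitaryPotential {d : ℕ} (K : Set (Space d)) (H : Space d → ℝ) : Prop where
  continuous : Continuous H
  eq_one : ∀ x ∈ K, H x = 1
  harmonic : InnerProductSpace.HarmonicOnNhd H Kᶜ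
  tendsto_zero : Tendsto H (cocompact (Space d)) (𝓝 0)

/-- The Dirichlet integral `‖∇ H‖²_{L²(ℝ^d)}`; the norm of the derivative is the Euclidean norm of
the gradient. For a capacitary potential of `K` the integrand vanishes on `K`, because every
point of `K` is a maximum of `H`. -/
def dirichletEnergy {d : ℕ} (H : Space d → ℝ) : ℝ :=
  ∫ x, ‖fderiv ℝ H x‖ ^ 2

open Classical in
/-- The Newtonian capacity of a compact set `K ⊆ ℝ^d`, `d ≥ 3`: the Dirichlet integral of the
capacitary potential of `K`. Some compact sets (with boundary points that are irregular for the
exterior Dirichlet problem, for instance a single point) have no continuous capacitary potential;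
for these the capacity is given by the usual variational formula
`inf {‖∇ φ‖² : φ ∈ C_c^∞(ℝ^d), φ ≥ 1 on K}`, with which the first formula agrees whenever the
potential exists. -/
def capacity {d : ℕ} (K : Set (Space d)) : ℝ :=
  if h : ∃ H, IsCapacitaryPotential K H then dirichletEnergy h.choose
  else sInf {e : ℝ | ∃ φ : Space d → ℝ, ContDiff ℝ ∞ φ ∧ HasCompactSupport φ ∧
    (∀ x ∈ K, 1 ≤ φ x) ∧ e = dirichletEnergy φ}

/-! ### The space `H⁻¹(Ω)` -/

/-- The norm of a test function in `H¹₀(Ω)`. -/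
def sobolevNorm {d : ℕ} {Ω : TopologicalSpace.Opens (Space d)} (φ : 𝓓(Ω, ℝ)) : ℝ :=
  Real.sqrt ((∫ x, φ x ^ 2) + ∫ x, ‖fderiv ℝ φ x‖ ^ 2)

/-- The norm in `H⁻¹(Ω) = (H¹₀(Ω))*` of a linear functional on test functions, with value `∞` if
the functional does not extend to `H¹₀(Ω)`, the closure of the test functions in `H¹`. Thus a
distribution `T` belongs to `H⁻¹(Ω)` if and only if `hMinusOneNorm T < ∞`. -/
def hMinusOneNorm {d : ℕ} {Ω : TopologicalSpace.Opens (Space d)} (T : 𝓓(Ω, ℝ) → ℝ) : ℝ≥0∞ :=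
  ⨆ (φ : 𝓓(Ω, ℝ)) (_ : sobolevNorm φ ≤ 1), ENNReal.ofReal |T φ|

/-- The functional `φ ↦ ∫ f φ` on test functions defined by a function `f`. -/
def pairing {d : ℕ} (Ω : TopologicalSpace.Opens (Space d)) (f : Space d → ℝ) :
    𝓓(Ω, ℝ) → ℝ :=
  fun φ => ∫ x, f x * φ x

/-! ### Perforations -/

/-- The function `∑_i (c_i / |A_i|) 1_{A_i}`. -/
def density {d : ℕ} {ι : Type*} (c : ι → ℝ) (A : ι → Set (Space d)) (x : Space d) : ℝ :=
  ∑' i, (A i).indicator (fun _ => c i / volume.real (A i)) x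

/-- `closedBall x a` is the minimal closed ball that contains the (nonempty) set `K`. -/
def IsMinimalBall {d : ℕ} (K : Set (Space d)) (x : Space d) (a : ℝ) : Prop :=
  K ⊆ Metric.closedBall x a ∧ ∀ y r, K ⊆ Metric.closedBall y r → a ≤ r

/-- The indices `i ∈ Λ^ε` of the holes that meet `Ω`. All sums, unions and suprema over the holes
run over these. -/
abbrev Active {d : ℕ} (Ω : TopologicalSpace.Opens (Space d)) {Λ : ℝ → Type*}
    (K : (ε : ℝ) → Λ ε → Set (Space d)) (ε : ℝ) : Type _ :=
  {i : Λ ε // ((Ω : Set (Space d)) ∩ K ε i).Nonempty}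

/-- The assumptions on the holes `K ε i`, on their minimal balls `closedBall (x ε i) (a ε i)`, on
the radii `R ε i` of the separating balls, on the tiles `A ε i`, and on the distribution `μ`.
Everything is asked only for all sufficiently small `ε > 0` and for the holes that meet `Ω`. -/
structure HoleAssumptions {d : ℕ} (Ω : TopologicalSpace.Opens (Space d)) {Λ : ℝ → Type*}
    (K : (ε : ℝ) → Λ ε → Set (Space d)) (x : (ε : ℝ) → Λ ε → Space d)
    (a R : (ε : ℝ) → Λ ε → ℝ) (A : (ε : ℝ) → Λ ε → Set (Space d)) (μ : 𝓓'(Ω, ℝ)) : Prop where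
  isCompact : ∀ᶠ ε in 𝓝[>] (0 : ℝ), ∀ i : Active Ω K ε, IsCompact (K ε i)
  minimalBall : ∀ᶠ ε in 𝓝[>] (0 : ℝ), ∀ i : Active Ω K ε, IsMinimalBall (K ε i) (x ε i) (a ε i)
  radius_pos : ∀ᶠ ε in 𝓝[>] (0 : ℝ), ∀ i : Active Ω K ε, 0 < R ε i
  disjoint_balls : ∀ᶠ ε in 𝓝[>] (0 : ℝ), Pairwise fun i j : Active Ω K ε =>
    Disjoint (Metric.ball (x ε i) (R ε i)) (Metric.ball (x ε j) (R ε j))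
  measurable_tile : ∀ᶠ ε in 𝓝[>] (0 : ℝ), ∀ i : Active Ω K ε, NullMeasurableSet (A ε i) volume
  ball_subset_tile : ∀ᶠ ε in 𝓝[>] (0 : ℝ), ∀ i : Active Ω K ε,
    Metric.ball (x ε i) (R ε i) ⊆ A ε i
  /-- `sup R_{iε} < ∞` -/
  radius_bounded : ∃ C : ℝ, ∀ᶠ ε in 𝓝[>] (0 : ℝ), ∀ i : Active Ω K ε, R ε i ≤ C
  /-- `sup a_{iε} / R_{iε} < 1` -/
  ratio_bounded : ∃ c < (1 : ℝ), ∀ᶠ ε in 𝓝[>] (0 : ℝ), ∀ i : Active Ω K ε, a ε i / R ε i ≤ c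
  /-- `∑ a_{iε}^{2(d-2)} R_{iε}^{-d+2} → 0` -/
  sum_interaction : Tendsto
    (fun ε => ∑' i : Active Ω K ε, ENNReal.ofReal (a ε i ^ (2 * (d - 2)) / R ε i ^ (d - 2)))
    (𝓝[>] (0 : ℝ)) (𝓝 0)
  /-- `sup |A_i^ε| R_{iε}^{-d} < ∞` -/
  volume_tile : ∃ C : ℝ, ∀ᶠ ε in 𝓝[>] (0 : ℝ), ∀ i : Active Ω K ε,
    volume (A ε i) ≤ ENNReal.ofReal (C * R ε i ^ d)
  /-- `∑ a_{iε}^{d-2} diam A_i^ε → 0` -/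
  sum_diam : Tendsto
    (fun ε => ∑' i : Active Ω K ε, ENNReal.ofReal (a ε i ^ (d - 2)) * Metric.ediam (A ε i))
    (𝓝[>] (0 : ℝ)) (𝓝 0)
  /-- `∑ (a_{iε}^{d-2} / |A_i^ε|) 1_{A_i^ε}` converges in the norm of `H⁻¹(Ω)`. -/
  converges : ∃ ν : 𝓓'(Ω, ℝ), hMinusOneNorm ν < ⊤ ∧ Tendsto
    (fun ε => hMinusOneNorm fun φ : 𝓓(Ω, ℝ) =>
      pairing Ω (density (fun i : Active Ω K ε => a ε i ^ (d - 2)) fun i => A ε i) φ - ν φ)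
    (𝓝[>] (0 : ℝ)) (𝓝 0)
  /-- `sup ∑ a_{iε}^{d-2} < ∞` -/
  sum_bounded : ∃ C : ℝ, ∀ᶠ ε in 𝓝[>] (0 : ℝ),
    ∑' i : Active Ω K ε, ENNReal.ofReal (a ε i ^ (d - 2)) ≤ ENNReal.ofReal C
  /-- `∑ (cap(K_i^ε) / |A_i^ε|) 1_{A_i^ε} → μ` in `𝓓'(Ω)` -/
  limit_density : ∀ φ : 𝓓(Ω, ℝ), Tendsto
    (fun ε => pairing Ω
      (density (fun i : Active Ω K ε => capacity (K ε i)) fun i => A ε i) φ)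
    (𝓝[>] (0 : ℝ)) (𝓝 (μ φ))

end Perforated

end

open Filter Topology MeasureTheory Set
open scoped ENNReal ContDiff Distributions

noncomputable section

namespace Perforated

/-! The proof is a domination argument. A set inside a ball of radius `a` has capacity at most `C *
a ^ (d - 2)` (`exists_capacity_le`), so the capacity densities are nonnegative and bounded by `C`
times the densities of `a ^ (d - 2)`, which converge in `H⁻¹(Ω)` to some `ν`.

Domination upgrades distributional convergence to norm convergence
(`tendsto_hMinusOneNorm_of_dominated`). For `u` in the unit ball of `H¹₀`, the dominated functional
at `u` is at most `C` times the dominating one at `|u|`, hence at most about `C ν(|u|)`. An element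
of `H⁻¹` is, up to a small error on the unit ball, integration against an `L²` function
(`exists_abs_le_add_mul_integral_sq`), so this is small when `u` is small in `L²`. The functionals
are therefore asymptotically equicontinuous on the `H¹₀` ball for the `L²` distance. By Rellich's
theorem (`exists_finite_l2_net`) that ball has a finite `L²` net, and on a finite set distributional
convergence suffices. Since `|u|` is not a test function, it is replaced by `√(u² + δ²) - δ`; the
error is `δ` times the total mass `∑ a ^ (d - 2)`, which stays bounded.

The capacity bound has two cases. In the variational one, a rescaled bump is a competitor. For a
potential `H`, the maximum principle gives `0 ≤ H ≤ 1`; Green's formula with a truncation of `H` and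
a cutoff `φ` equal to `1` near `K` bounds the energy by `∫ |Δφ|`, and scaling gives the power `d -
2`.

For the last assertion, pairing a density with a test function gives a weighted sum of averages over
the sets. Passing from the average over a tile to the average over its hole changes a Lipschitz
function by at most `2 L` times the diameter of the tile, and the weighted sum of the diameters
tends to zero. -/

/-! ### Calculus on Euclidean space -/

/-- The partial derivative `∂_j f`. -/
def partialDeriv {d : ℕ} (j : Fin d) (f : Space d → ℝ) (x : Space d) : ℝ :=
  fderiv ℝ f x (EuclideanSpace.basisFun (Fin d) ℝ j)

theorem norm_sq_eq_sum_sq {d : ℕ} (L : Space d →L[ℝ] ℝ) :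
    ‖L‖ ^ 2 = ∑ j, L (EuclideanSpace.basisFun (Fin d) ℝ j) ^ 2 := by
  set v := (InnerProductSpace.toDual ℝ (Space d)).symm L with hv
  have hL : ∀ y, L y = inner ℝ v y := fun y => by
    rw [hv, InnerProductSpace.toDual_symm_apply]
  have hn : ‖L‖ = ‖v‖ := by rw [hv, LinearIsometryEquiv.norm_map]
  rw [hn, ← (EuclideanSpace.basisFun (Fin d) ℝ).sum_sq_norm_inner_left v]
  refine Finset.sum_congr rfl fun j _ => ?_
  rw [hL, Real.norm_eq_abs, sq_abs]

theorem norm_fderiv_sq {d : ℕ} (f : Space d → ℝ) (x : Space d) :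
    ‖fderiv ℝ f x‖ ^ 2 = ∑ j, partialDeriv j f x ^ 2 :=
  norm_sq_eq_sum_sq _

theorem partialDeriv_partialDeriv {d : ℕ} {f : Space d → ℝ} {x : Space d} (j : Fin d)
    (hf : ContDiffAt ℝ 2 f x) :
    partialDeriv j (partialDeriv j f) x =
      iteratedFDeriv ℝ 2 f x ![EuclideanSpace.basisFun (Fin d) ℝ j,
        EuclideanSpace.basisFun (Fin d) ℝ j] := by
  have h1 : DifferentiableAt ℝ (fderiv ℝ f) x :=
    (hf.fderiv_right (m := 1) (by norm_num)).differentiableAt (by norm_num)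
  rw [iteratedFDeriv_two_apply]
  unfold partialDeriv
  rw [fderiv_clm_apply h1 (by fun_prop)]
  simp

theorem laplacian_eq_sum_partialDeriv {d : ℕ} {f : Space d → ℝ} {x : Space d}
    (hf : ContDiffAt ℝ 2 f x) :
    Laplacian.laplacian f x = ∑ j, partialDeriv j (partialDeriv j f) x := by
  rw [InnerProductSpace.laplacian_eq_iteratedFDeriv_orthonormalBasis f
    (EuclideanSpace.basisFun (Fin d) ℝ)]
  exact Finset.sum_congr rfl fun j _ => (partialDeriv_partialDeriv j hf).symm

theorem contDiffOn_partialDeriv {d : ℕ} {f : Space d → ℝ} {V : Set (Space d)} {m n : ℕ∞}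
    (hV : IsOpen V) (hf : ContDiffOn ℝ n f V) (hmn : m + 1 ≤ n) (j : Fin d) :
    ContDiffOn ℝ m (partialDeriv j f) V :=
  (hf.fderiv_of_isOpen hV (by exact_mod_cast hmn)).clm_apply contDiffOn_const

theorem contDiff_partialDeriv {d : ℕ} {f : Space d → ℝ} {m n : ℕ∞}
    (hf : ContDiff ℝ n f) (hmn : m + 1 ≤ n) (j : Fin d) :
    ContDiff ℝ m (partialDeriv j f) :=
  (hf.fderiv_right (by exact_mod_cast hmn)).clm_apply contDiff_const

theorem tsupport_partialDeriv_subset {d : ℕ} (f : Space d → ℝ) (j : Fin d) :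
    tsupport (partialDeriv j f) ⊆ tsupport f :=
  (closure_mono (fun x hx => by
    rw [Function.mem_support] at hx ⊢
    contrapose! hx
    simp [partialDeriv, hx])).trans (tsupport_fderiv_subset ℝ (f := f))

theorem hasCompactSupport_partialDeriv {d : ℕ} {f : Space d → ℝ} (hf : HasCompactSupport f)
    (j : Fin d) : HasCompactSupport (partialDeriv j f) :=
  hf.mono' (subset_closure.trans (tsupport_partialDeriv_subset f j))

/-- Off the support of `g` the product is locally zero, so `f` may be arbitrary outside `V`. This
allows derivatives of a potential, which are controlled only off `K`, to be multiplied by functions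
supported there. -/
theorem continuous_mul_of_tsupport_subset {X : Type*} [TopologicalSpace X]
    {f g : X → ℝ} {V : Set X} (hV : IsOpen V)
    (hf : ContinuousOn f V) (hg : Continuous g) (hgV : tsupport g ⊆ V) :
    Continuous (fun x => f x * g x) :=
  continuous_of_tsupport fun _ hx =>
    ((hf.continuousAt (hV.mem_nhds (hgV (tsupport_mul_subset_right hx)))).mul hg.continuousAt)

theorem integrable_mul_of_tsupport_subset {d : ℕ}
    {f g : Space d → ℝ} {V : Set (Space d)} (hV : IsOpen V)
    (hf : ContinuousOn f V) (hg : Continuous g) (hgV : tsupport g ⊆ V)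
    (hgc : HasCompactSupport g) : Integrable (fun x => f x * g x) :=
  (continuous_mul_of_tsupport_subset hV hf hg hgV).integrable_of_hasCompactSupport
    hgc.mul_left

/-- Integration by parts against a compactly supported function. -/
theorem integral_mul_partialDeriv {d : ℕ} {u w : Space d → ℝ} {V : Set (Space d)}
    (hV : IsOpen V) (hu : ContDiffOn ℝ 1 u V) (hw : ContDiff ℝ 1 w) (hwV : tsupport w ⊆ V)
    (hwc : HasCompactSupport w) (j : Fin d) :
    ∫ x, u x * partialDeriv j w x = - ∫ x, partialDeriv j u x * w x := by
  have h1 : Continuous (partialDeriv j w) :=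
    (contDiff_partialDeriv (m := 0) (n := 1) hw (by norm_num) j).continuous
  have h2 : ContinuousOn (partialDeriv j u) V :=
    (contDiffOn_partialDeriv (m := 0) (n := 1) hV hu (by norm_num) j).continuousOn
  exact integral_mul_fderiv_eq_neg_fderiv_mul_of_integrable
    (integrable_mul_of_tsupport_subset hV h2 hw.continuous hwV hwc)
    (integrable_mul_of_tsupport_subset hV hu.continuousOn h1
      ((tsupport_partialDeriv_subset w j).trans hwV) (hasCompactSupport_partialDeriv hwc j))
    (integrable_mul_of_tsupport_subset hV hu.continuousOn hw.continuous hwV hwc)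
    (fun x hx => (hu.differentiableOn (by norm_num)).differentiableAt (hV.mem_nhds (hwV hx)))
    (fun x _ => (hw.differentiable (by norm_num)).differentiableAt)

/-! ### The maximum principle -/

/-- By the second derivative test a local maximum would also be a local minimum; then `f` is locally
constant and its second derivative vanishes. -/
theorem not_isLocalMax_of_deriv_deriv_pos {f : ℝ → ℝ} {t : ℝ} (h : 0 < deriv (deriv f) t)
    (hc : ContinuousAt f t) : ¬ IsLocalMax f t := fun hmax => by
  have hmin := isLocalMin_of_deriv_deriv_pos h hmax.deriv_eq_zero hc
  have hconst : f =ᶠ[𝓝 t] fun _ => f t := by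
    filter_upwards [hmax, hmin] with s h1 h2 using le_antisymm h1 h2
  have h0 : deriv (deriv f) t = 0 := by
    rw [hconst.deriv.deriv_eq]
    simp
  exact h.ne' h0

theorem partialDeriv_partialDeriv_nonpos_of_isLocalMax {d : ℕ} {f : Space d → ℝ} {x : Space d}
    (hf : ContDiffAt ℝ 2 f x) (hmax : IsLocalMax f x) (j : Fin d) :
    partialDeriv j (partialDeriv j f) x ≤ 0 := by
  by_contra! hpos
  set e := EuclideanSpace.basisFun (Fin d) ℝ j with he
  have hl : ∀ t : ℝ, HasDerivAt (fun s : ℝ => x + s • e) e t := fun t => by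
    simpa using ((hasDerivAt_id t).smul_const e).const_add x
  have hcont : Tendsto (fun s : ℝ => x + s • e) (𝓝 0) (𝓝 x) := by
    have := (hl 0).continuousAt.tendsto
    simpa using this
  have hd1 : deriv (fun s : ℝ => f (x + s • e)) =ᶠ[𝓝 0]
      fun s => partialDeriv j f (x + s • e) := by
    have : ∀ᶠ y in 𝓝 x, DifferentiableAt ℝ f y :=
      (hf.eventually (by simp)).mono fun y hy => hy.differentiableAt (by norm_num)
    filter_upwards [hcont.eventually this] with s hs
    exact (hs.hasFDerivAt.comp_hasDerivAt s (hl s)).deriv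
  have h1 : DifferentiableAt ℝ (partialDeriv j f) x :=
    ((hf.fderiv_right (m := 1) (by norm_num)).differentiableAt (by norm_num)).clm_apply
      (differentiableAt_const _)
  have hd2 : deriv (deriv (fun s : ℝ => f (x + s • e))) 0 =
      partialDeriv j (partialDeriv j f) x := by
    rw [hd1.deriv_eq]
    have h1' : DifferentiableAt ℝ (partialDeriv j f) (x + (0 : ℝ) • e) := by simpa using h1
    refine (h1'.hasFDerivAt.comp_hasDerivAt (0 : ℝ) (hl 0)).deriv.trans ?_
    simp [partialDeriv, he]
  have hc : ContinuousAt (fun s : ℝ => f (x + s • e)) 0 := by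
    have h2 : ContinuousAt f (x + (0 : ℝ) • e) := by simpa using hf.continuousAt
    exact ContinuousAt.comp (f := fun s : ℝ => x + s • e) h2 (hl 0).continuousAt
  refine not_isLocalMax_of_deriv_deriv_pos (by rw [hd2]; exact hpos) hc ?_
  have := hcont.eventually hmax
  filter_upwards [this] with s hs
  simpa using hs

theorem laplacian_nonpos_of_isLocalMax {d : ℕ} {f : Space d → ℝ} {x : Space d}
    (hf : ContDiffAt ℝ 2 f x) (hmax : IsLocalMax f x) : Laplacian.laplacian f x ≤ 0 := by
  rw [laplacian_eq_sum_partialDeriv hf]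
  exact Finset.sum_nonpos fun j _ => partialDeriv_partialDeriv_nonpos_of_isLocalMax hf hmax j

theorem laplacian_norm_sub_sq {d : ℕ} (x₀ x : Space d) :
    Laplacian.laplacian (fun y : Space d => ‖y - x₀‖ ^ 2) x = 2 * d := by
  have hc : ContDiff ℝ 2 (fun y : Space d => ‖y - x₀‖ ^ 2) :=
    (contDiff_id.sub contDiff_const).norm_sq ℝ
  rw [laplacian_eq_sum_partialDeriv hc.contDiffAt]
  have h1 : ∀ j, partialDeriv j (fun y : Space d => ‖y - x₀‖ ^ 2) =
      fun y => 2 * inner ℝ (y - x₀) (EuclideanSpace.basisFun (Fin d) ℝ j) := fun j => by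
    funext y
    have := ((hasFDerivAt_id y).sub_const x₀).norm_sq
    refine (congrArg (fun L => L (EuclideanSpace.basisFun (Fin d) ℝ j)) this.fderiv).trans ?_
    simp [inner_sub_left]
  have h2 : ∀ j, partialDeriv j (partialDeriv j (fun y : Space d => ‖y - x₀‖ ^ 2)) x = 2 := by
    intro j
    rw [h1]
    have := (((hasFDerivAt_id x).sub_const x₀).inner ℝ
      (hasFDerivAt_const (EuclideanSpace.basisFun (Fin d) ℝ j) x)).const_mul (2 : ℝ)
    refine (congrArg (fun L => L (EuclideanSpace.basisFun (Fin d) ℝ j)) this.fderiv).trans ?_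
    simp
  simp [h2, mul_comm]

/-- The maximum principle on the complement of a compact set. -/
theorem le_of_harmonicOnNhd_compl {d : ℕ} (hd : 0 < d) {K : Set (Space d)} {H : Space d → ℝ}
    {M : ℝ} (hM : 0 ≤ M) (hc : Continuous H) (hK : ∀ x ∈ K, H x ≤ M)
    (hH : InnerProductSpace.HarmonicOnNhd H Kᶜ)
    (h0 : Tendsto H (cocompact (Space d)) (𝓝 0)) (x : Space d) : H x ≤ M := by
  by_contra! hx
  -- A level strictly between `M` and `H x`. It is positive, so the decay of `H` makes the
  -- superlevel set compact, and it exceeds `M`, so this set avoids `K`.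
  set m := (M + H x) / 2 with hm
  have hm1 : M < m := by rw [hm]; linarith
  have hm2 : m < H x := by rw [hm]; linarith
  have hScl : IsClosed {y | m ≤ H y} := isClosed_le continuous_const hc
  have hS : IsCompact {y | m ≤ H y} := by
    have : ∀ᶠ y in cocompact (Space d), H y < m := h0.eventually_lt_const (hM.trans_lt hm1)
    obtain ⟨T, hT, hTs⟩ := mem_cocompact.1 this
    refine hT.of_isClosed_subset hScl fun y hy => ?_
    by_contra hyT
    exact (show H y < m from hTs hyT).not_ge hy
  obtain ⟨ρ, hρ⟩ := hS.isBounded.subset_closedBall x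
  have hρ0 : 0 ≤ ρ := by
    have := hρ (show x ∈ {y | m ≤ H y} from hm2.le)
    simpa using this
  -- Small enough that the quadratic term cannot bridge the gap `H x - m` on the superlevel set. The
  -- maximum of `V` is then attained where `m < H`, so it is a local maximum, although the Laplacian
  -- of `V` there is `2 d η > 0`.
  set η := (H x - m) / (2 * (ρ ^ 2 + 1)) with hη
  have hη0 : 0 < η := div_pos (by linarith) (by positivity)
  have hηρ : η * ρ ^ 2 < H x - m := by
    rw [hη, div_mul_eq_mul_div, div_lt_iff₀ (by positivity)]
    nlinarith [sq_nonneg ρ, sub_pos.2 hm2]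
  set V : Space d → ℝ := fun y => H y + η * ‖y - x‖ ^ 2 with hV
  have hVc : Continuous V := by rw [hV]; fun_prop
  obtain ⟨p, hp, hpmax⟩ := hS.exists_isMaxOn ⟨x, hm2.le⟩ hVc.continuousOn
  have hVx : H x ≤ V p := by
    have := hpmax (show x ∈ {y | m ≤ H y} from hm2.le)
    simpa [hV] using this
  have hpb : ‖p - x‖ ^ 2 ≤ ρ ^ 2 := by
    have : ‖p - x‖ ≤ ρ := by simpa [dist_eq_norm] using hρ hp
    gcongr
  have hHp : m < H p := by
    have h1 : V p ≤ H p + η * ρ ^ 2 := by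
      show H p + η * ‖p - x‖ ^ 2 ≤ _
      gcongr
    linarith
  have hpK : p ∈ Kᶜ := fun h => by linarith [hK p h]
  have hloc : IsLocalMax V p := by
    filter_upwards [(isOpen_lt continuous_const hc).mem_nhds hHp] with y hy
    exact hpmax (show m ≤ H y from le_of_lt hy)
  have hHC := (hH p hpK).1
  have hqC : ContDiff ℝ 2 (fun y : Space d => ‖y - x‖ ^ 2) :=
    (contDiff_id.sub contDiff_const).norm_sq ℝ
  have hVeq : V = H + η • (fun y : Space d => ‖y - x‖ ^ 2) := by
    funext y; simp [hV]
  have hVC : ContDiffAt ℝ 2 V p := by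
    rw [hVeq]; exact hHC.add (hqC.contDiffAt.const_smul η)
  have h1 := laplacian_nonpos_of_isLocalMax hVC hloc
  rw [hVeq, hHC.laplacian_add (f₂ := η • fun y : Space d => ‖y - x‖ ^ 2) (hqC.contDiffAt.const_smul η),
    InnerProductSpace.laplacian_smul η hqC.contDiffAt, laplacian_norm_sub_sq,
    (hH p hpK).2.self_of_nhds] at h1
  have : (0 : ℝ) < d := by exact_mod_cast hd
  simp only [Pi.zero_apply, zero_add, smul_eq_mul] at h1
  nlinarith

theorem IsCapacitaryPotential.le_one {d : ℕ} (hd : 0 < d) {K : Set (Space d)} {H : Space d → ℝ}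
    (h : IsCapacitaryPotential K H) (x : Space d) : H x ≤ 1 :=
  le_of_harmonicOnNhd_compl hd zero_le_one h.continuous (fun y hy => (h.eq_one y hy).le)
    h.harmonic h.tendsto_zero x

theorem IsCapacitaryPotential.nonneg {d : ℕ} (hd : 0 < d) {K : Set (Space d)} {H : Space d → ℝ}
    (h : IsCapacitaryPotential K H) (x : Space d) : 0 ≤ H x := by
  have hh : InnerProductSpace.HarmonicOnNhd (-H) Kᶜ := h.harmonic.neg
  have := le_of_harmonicOnNhd_compl hd le_rfl h.continuous.neg
    (fun y hy => by simp [h.eq_one y hy]) hh (by rw [← neg_zero]; exact h.tendsto_zero.neg) x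
  simpa using this

/-! ### Capacity is bounded by the power `d - 2` of the radius -/

/-- A `C²` truncation `g` of the identity of `[0, 1]`, constant near `0` and near `1`. -/
theorem exists_smooth_truncation {δ : ℝ} (hδ : 0 < δ) (hδ' : δ < 1 / 4) :
    ∃ (g β : ℝ → ℝ) (c : ℝ), ContDiff ℝ 2 g ∧ (∀ s, HasDerivAt g (β s) s) ∧
      (∀ s, 0 ≤ β s) ∧ (∀ s ∈ Icc (2 * δ) (1 - 2 * δ), β s = 1) ∧
      (∀ s ≤ δ, g s = 0) ∧ (∀ s, 1 - δ ≤ s → g s = c) ∧ 0 ≤ c ∧ c ≤ 1 := by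
  -- The derivative of the truncation: `1` on `[2δ, 1 - 2δ]` and `0` outside `(δ, 1 - δ)`. The inner
  -- radius is positive because `δ < 1 / 4`.
  let β : ContDiffBump (1 / 2 : ℝ) := ⟨1 / 2 - 2 * δ, 1 / 2 - δ, by linarith, by linarith⟩
  have hβ : Continuous β := β.continuous
  have hD : ∀ s, HasDerivAt (fun s : ℝ => ∫ t in (0 : ℝ)..s, β t) (β s) s := fun s =>
    intervalIntegral.integral_hasDerivAt_right (hβ.intervalIntegrable _ _)
      (hβ.stronglyMeasurableAtFilter _ _) hβ.continuousAt
  have hzero : ∀ t, (t ≤ δ ∨ 1 - δ ≤ t) → β t = 0 := fun t ht =>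
    β.zero_of_le_dist (by
      rw [Real.dist_eq]
      show 1 / 2 - δ ≤ _
      rcases ht with ht | ht
      · rw [abs_of_nonpos] <;> linarith
      · rw [abs_of_nonneg] <;> linarith)
  refine ⟨fun s => ∫ t in (0 : ℝ)..s, β t, β, ∫ t in (0 : ℝ)..1, β t, ?_, hD,
    fun s => β.nonneg, fun s hs => ?_, fun s hs => ?_, fun s hs => ?_, ?_, ?_⟩
  · have : (2 : ℕ∞ω) = 1 + 1 := by norm_num
    rw [this, contDiff_succ_iff_deriv]
    refine ⟨fun s => (hD s).differentiableAt, by simp, ?_⟩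
    rw [funext fun s => (hD s).deriv]
    exact β.contDiff
  · refine β.one_of_mem_closedBall ?_
    rw [Metric.mem_closedBall, Real.dist_eq, abs_le]
    show -(1 / 2 - 2 * δ) ≤ _ ∧ _ ≤ 1 / 2 - 2 * δ
    constructor <;> linarith [hs.1, hs.2]
  · have : EqOn β (fun _ => 0) (uIcc 0 s) := fun t ht => hzero t (Or.inl (by
      rcases le_total 0 s with h | h
      · rw [uIcc_of_le h] at ht; exact ht.2.trans hs
      · rw [uIcc_of_ge h] at ht; exact ht.2.trans hδ.le))
    simp only [intervalIntegral.integral_congr this, intervalIntegral.integral_zero]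
  · have : EqOn β (fun _ => 0) (uIcc 1 s) := fun t ht => hzero t (Or.inr (by
      rcases le_total 1 s with h | h
      · rw [uIcc_of_le h] at ht; linarith [ht.1]
      · rw [uIcc_of_ge h] at ht; linarith [ht.1]))
    have h2 := intervalIntegral.integral_add_adjacent_intervals (μ := volume)
      (hβ.intervalIntegrable 0 1) (hβ.intervalIntegrable 1 s)
    rw [intervalIntegral.integral_congr this, intervalIntegral.integral_zero, add_zero] at h2
    exact h2.symm
  · exact intervalIntegral.integral_nonneg zero_le_one fun t _ => β.nonneg
  · have := intervalIntegral.integral_mono_on (μ := volume) (zero_le_one (α := ℝ))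
      (hβ.intervalIntegrable 0 1) (continuous_const.intervalIntegrable 0 1)
      (fun t _ => β.le_one (x := t))
    simpa using this

/-- The flux of a harmonic function through the support of the gradient of a cutoff. -/
theorem integral_sum_partialDeriv_mul_eq_zero {d : ℕ} {V : Set (Space d)} (hV : IsOpen V)
    {H ζ : Space d → ℝ} (hH : InnerProductSpace.HarmonicOnNhd H V) (hζ : ContDiff ℝ 2 ζ)
    (hζc : HasCompactSupport ζ) (hζV : tsupport ζ ⊆ V) :
    ∑ j, ∫ x, partialDeriv j H x * partialDeriv j ζ x = 0 := by
  have h1 : ∀ j, ContDiffOn ℝ 1 (partialDeriv j H) V := fun j =>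
    contDiffOn_partialDeriv (m := 1) (n := 2) hV hH.contDiffOn (by norm_num) j
  have h2 : ∀ j, ContinuousOn (partialDeriv j (partialDeriv j H)) V := fun j =>
    (contDiffOn_partialDeriv (m := 0) (n := 1) hV (h1 j) (by norm_num) j).continuousOn
  rw [Finset.sum_congr rfl fun j _ =>
    integral_mul_partialDeriv hV (h1 j) (hζ.of_le (by norm_num)) hζV hζc j,
    Finset.sum_neg_distrib, ← integral_finsetSum _ fun j _ =>
    integrable_mul_of_tsupport_subset hV (h2 j) hζ.continuous hζV hζc, neg_eq_zero]
  refine integral_eq_zero_of_ae (Eventually.of_forall fun x => ?_)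
  by_cases hx : x ∈ tsupport ζ
  · have := (hH x (hζV hx)).2.self_of_nhds
    rw [laplacian_eq_sum_partialDeriv (hH x (hζV hx)).1] at this
    simp only [Pi.zero_apply] at this ⊢
    rw [← Finset.sum_mul, this, zero_mul]
  · simp [image_eq_zero_of_notMem_tsupport hx]

/-- A potential need not be differentiable on the boundary of `K`, and its energy is not known to be
finite beforehand. The composition `g ∘ H` avoids both difficulties: it is `C²`, constant near `K`
and compactly supported, so Green's formula applies to it. The resulting bound does not depend on
the truncation. -/
theorem IsCapacitaryPotential.lintegral_truncation_le {d : ℕ} (hd : 0 < d) {K : Set (Space d)}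
    (hK : IsClosed K) {H φ : Space d → ℝ} (h : IsCapacitaryPotential K H)
    (hφ : ContDiff ℝ ∞ φ) (hφc : HasCompactSupport φ) (hφ1 : ∀ x ∈ K, φ =ᶠ[𝓝 x] fun _ => 1)
    {g β : ℝ → ℝ} {c δ : ℝ} (hδ : 0 < δ) (hg : ContDiff ℝ 2 g) (hgβ : ∀ s, HasDerivAt g (β s) s)
    (hβ : ∀ s, 0 ≤ β s) (hg0 : ∀ s ≤ δ, g s = 0) (hg1 : ∀ s, 1 - δ ≤ s → g s = c)
    (hc0 : 0 ≤ c) (hc1 : c ≤ 1) :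
    ∫⁻ x, ENNReal.ofReal (β (H x) * ‖fderiv ℝ H x‖ ^ 2) ≤
      ENNReal.ofReal (∫ x, |∑ j, partialDeriv j (partialDeriv j φ) x|) := by
  have hV : IsOpen Kᶜ := hK.isOpen_compl
  have hHC : ContDiffOn ℝ 2 H Kᶜ := h.harmonic.contDiffOn
  have hgH1 : ∀ x ∈ K, (fun y => g (H y)) =ᶠ[𝓝 x] fun _ => c := fun x hx => by
    have : ∀ᶠ y in 𝓝 x, 1 - δ < H y :=
      h.continuous.continuousAt.eventually_const_lt (by rw [h.eq_one x hx]; linarith)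
    filter_upwards [this] with y hy using hg1 _ hy.le
  have hGC : ContDiff ℝ 2 (fun y => g (H y)) := contDiff_iff_contDiffAt.2 fun x => by
    by_cases hx : x ∈ K
    · exact contDiffAt_const.congr_of_eventuallyEq (hgH1 x hx)
    · exact hg.contDiffAt.comp x (hHC.contDiffAt (hV.mem_nhds hx))
  have hGc : HasCompactSupport (fun y => g (H y)) := by
    have : ∀ᶠ y in cocompact (Space d), H y < δ := h.tendsto_zero.eventually_lt_const hδ
    obtain ⟨T, hT, hTs⟩ := mem_cocompact.1 this
    refine HasCompactSupport.intro hT fun x hx => hg0 _ ?_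
    exact (show H x < δ from hTs hx).le
  have hGd : ∀ x ∈ Kᶜ, ∀ j, partialDeriv j (fun y => g (H y)) x = β (H x) * partialDeriv j H x := by
    intro x hx j
    have hHd := (hHC.contDiffAt (hV.mem_nhds hx)).differentiableAt (by norm_num)
    have := (hgβ (H x)).comp_hasFDerivAt x hHd.hasFDerivAt
    refine (congrArg (fun L => L (EuclideanSpace.basisFun (Fin d) ℝ j)) this.fderiv).trans ?_
    simp [partialDeriv]
  have hφ2 : ContDiff ℝ 2 φ := contDiff_infty.1 hφ 2
  -- Both terms equal `c` near `K`, so `ζ` is supported off `K`, where `H` is harmonic, and `∫ ∇H ·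
  -- ∇ζ = 0`. The gradient of `g ∘ H` may thus be replaced by that of `c φ`.
  set ζ : Space d → ℝ := fun y => c * φ y - g (H y) with hζdef
  have hζC : ContDiff ℝ 2 ζ := (contDiff_const.mul hφ2).sub hGC
  have hζc : HasCompactSupport ζ := (hφc.mul_left (f := fun _ => c)).sub hGc
  have hζV : tsupport ζ ⊆ Kᶜ := fun x hx hxK => by
    rw [← notMem_compl_iff] at hxK
    refine hxK (fun hxK => ?_)
    refine (notMem_tsupport_iff_eventuallyEq.2 ?_) hx
    filter_upwards [hφ1 x hxK, hgH1 x hxK] with y h1 h2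
    simp [hζdef, h1, h2]
  have hζd : ∀ x j, c * partialDeriv j φ x = partialDeriv j ζ x +
      partialDeriv j (fun y => g (H y)) x := fun x j => by
    have h1 := (hφ2.differentiable (by norm_num) x).hasFDerivAt.const_mul c
    have h2 := (hGC.differentiable (by norm_num) x).hasFDerivAt
    have h3 := (congrArg (fun L => L (EuclideanSpace.basisFun (Fin d) ℝ j)) (h1.sub h2).fderiv)
    have h4 : partialDeriv j ζ x =
      c * partialDeriv j φ x - partialDeriv j (fun y => g (H y)) x := h3
    rw [h4]; ring
  have hGV : ∀ j, tsupport (partialDeriv j (fun y => g (H y))) ⊆ Kᶜ := fun j x hx hxK => by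
    refine (notMem_tsupport_iff_eventuallyEq.2 ?_) hx
    have : ∀ᶠ y in 𝓝 x, (fun y => g (H y)) =ᶠ[𝓝 y] fun _ => c := (hgH1 x hxK).eventually_nhds
    filter_upwards [this] with y hy
    rw [partialDeriv, hy.fderiv_eq]
    simp
  have hφV : ∀ j, tsupport (partialDeriv j φ) ⊆ Kᶜ := fun j x hx hxK => by
    refine (notMem_tsupport_iff_eventuallyEq.2 ?_) hx
    have : ∀ᶠ y in 𝓝 x, φ =ᶠ[𝓝 y] fun _ => 1 := (hφ1 x hxK).eventually_nhds
    filter_upwards [this] with y hy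
    rw [partialDeriv, hy.fderiv_eq]
    simp
  have hdH : ∀ j, ContinuousOn (partialDeriv j H) Kᶜ := fun j =>
    (contDiffOn_partialDeriv (m := 0) (n := 2) hV hHC (by norm_num) j).continuousOn
  have hdφ : ∀ j, ContDiff ℝ 1 (partialDeriv j φ) := fun j =>
    contDiff_partialDeriv (m := 1) (n := 2) hφ2 (by norm_num) j
  have hddφ : ∀ j, Continuous (partialDeriv j (partialDeriv j φ)) := fun j =>
    (contDiff_partialDeriv (m := 0) (n := 1) (hdφ j) (by norm_num) j).continuous
  have hdζ : ∀ j, Continuous (partialDeriv j ζ) := fun j =>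
    (contDiff_partialDeriv (m := 0) (n := 2) hζC (by norm_num) j).continuous
  have hdG : ∀ j, Continuous (partialDeriv j (fun y => g (H y))) := fun j =>
    (contDiff_partialDeriv (m := 0) (n := 2) hGC (by norm_num) j).continuous
  have hIG : ∀ j, Integrable fun x => partialDeriv j H x * partialDeriv j (fun y => g (H y)) x :=
    fun j => integrable_mul_of_tsupport_subset hV (hdH j) (hdG j) (hGV j)
      (hasCompactSupport_partialDeriv hGc j)
  have hIζ : ∀ j, Integrable fun x => partialDeriv j H x * partialDeriv j ζ x :=
    fun j => integrable_mul_of_tsupport_subset hV (hdH j) (hdζ j)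
      ((tsupport_partialDeriv_subset ζ j).trans hζV) (hasCompactSupport_partialDeriv hζc j)
  have hddφc : ∀ j, HasCompactSupport (partialDeriv j (partialDeriv j φ)) := fun j =>
    hasCompactSupport_partialDeriv (hasCompactSupport_partialDeriv hφc j) j
  have hIφ : ∀ j, Integrable fun x => H x * partialDeriv j (partialDeriv j φ) x :=
    fun j => (h.continuous.mul (hddφ j)).integrable_of_hasCompactSupport (hddφc j).mul_left
  have hpoint : ∀ x, β (H x) * ‖fderiv ℝ H x‖ ^ 2 =
      ∑ j, partialDeriv j H x * partialDeriv j (fun y => g (H y)) x := fun x => by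
    by_cases hx : x ∈ K
    · have hb : β (H x) = 0 := by
        rw [h.eq_one x hx]
        have : g =ᶠ[𝓝 1] fun _ => c := by
          filter_upwards [lt_mem_nhds (show 1 - δ < 1 by linarith)] with s hs using hg1 s hs.le
        rw [← (hgβ 1).deriv, this.deriv_eq]
        simp
      rw [hb, zero_mul]
      refine (Finset.sum_eq_zero fun j _ => ?_).symm
      rw [partialDeriv, partialDeriv, (hgH1 x hx).fderiv_eq]
      simp
    · rw [norm_fderiv_sq, Finset.mul_sum]
      refine Finset.sum_congr rfl fun j _ => ?_
      rw [hGd x hx j]; ring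
  have hI : Integrable fun x => β (H x) * ‖fderiv ℝ H x‖ ^ 2 := by
    simp only [hpoint]
    exact integrable_finsetSum _ fun j _ => hIG j
  rw [← ofReal_integral_eq_lintegral_ofReal hI
    (Eventually.of_forall fun x => mul_nonneg (hβ _) (sq_nonneg _))]
  refine ENNReal.ofReal_le_ofReal ?_
  -- The left side is `∫ ∇H · ∇(g ∘ H) = c ∫ ∇H · ∇φ`. A second integration by parts moves the
  -- derivative from `H` to `φ`, which is legitimate because `∇φ` vanishes near `K`.
  have hkey : ∫ x, β (H x) * ‖fderiv ℝ H x‖ ^ 2 =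
      - (c * ∫ x, H x * ∑ j, partialDeriv j (partialDeriv j φ) x) := by
    simp only [hpoint, Finset.mul_sum]
    rw [integral_finsetSum _ fun j _ => hIG j, integral_finsetSum _ fun j _ => hIφ j]
    have e1 : ∀ j, ∫ x, partialDeriv j H x * partialDeriv j (fun y => g (H y)) x =
        c * (∫ x, partialDeriv j H x * partialDeriv j φ x) -
          ∫ x, partialDeriv j H x * partialDeriv j ζ x := fun j => by
      rw [← integral_const_mul, eq_sub_iff_add_eq, ← integral_add (hIG j) (hIζ j)]
      refine integral_congr_ae (Eventually.of_forall fun x => ?_)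
      have := hζd x j
      simp only
      linear_combination - partialDeriv j H x * this
    have e2 : ∀ j, ∫ x, H x * partialDeriv j (partialDeriv j φ) x =
        - ∫ x, partialDeriv j H x * partialDeriv j φ x := fun j =>
      integral_mul_partialDeriv hV (hHC.of_le (by norm_num)) (hdφ j) (hφV j)
        (hasCompactSupport_partialDeriv hφc j) j
    rw [Finset.sum_congr rfl fun j _ => e1 j, Finset.sum_sub_distrib,
      integral_sum_partialDeriv_mul_eq_zero hV h.harmonic hζC hζc hζV,
      Finset.sum_congr rfl fun j _ => e2 j, Finset.sum_neg_distrib, ← Finset.mul_sum]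
    ring
  have hIabs : Integrable fun x => |∑ j, partialDeriv j (partialDeriv j φ) x| :=
    (integrable_finsetSum _ fun j _ =>
      (hddφ j).integrable_of_hasCompactSupport (hddφc j)).abs
  have hle : |∫ x, H x * ∑ j, partialDeriv j (partialDeriv j φ) x| ≤
      ∫ x, |∑ j, partialDeriv j (partialDeriv j φ) x| := by
    rw [← Real.norm_eq_abs]
    refine norm_integral_le_of_norm_le hIabs (Eventually.of_forall fun x => ?_)
    rw [Real.norm_eq_abs, abs_mul, abs_of_nonneg (h.nonneg hd x)]
    exact mul_le_of_le_one_left (abs_nonneg _) (h.le_one hd x)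
  rw [hkey]
  set I := ∫ x, H x * ∑ j, partialDeriv j (partialDeriv j φ) x
  calc -(c * I) ≤ c * |I| := by nlinarith [neg_abs_le I, mul_le_mul_of_nonneg_left (neg_abs_le I) hc0]
    _ ≤ 1 * |I| := by gcongr
    _ ≤ _ := by simpa using hle

/-- Fatou's lemma, as the truncation parameter tends to zero in the uniform bound for truncated
energies. -/
theorem IsCapacitaryPotential.lintegral_energy_le {d : ℕ} (hd : 0 < d) {K : Set (Space d)}
    (hK : IsClosed K) {H φ : Space d → ℝ} (h : IsCapacitaryPotential K H)
    (hφ : ContDiff ℝ ∞ φ) (hφc : HasCompactSupport φ) (hφ1 : ∀ x ∈ K, φ =ᶠ[𝓝 x] fun _ => 1) :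
    ∫⁻ x, ENNReal.ofReal (‖fderiv ℝ H x‖ ^ 2) ≤
      ENNReal.ofReal (∫ x, |∑ j, partialDeriv j (partialDeriv j φ) x|) := by
  have hδ : ∀ n : ℕ, 0 < 1 / ((n : ℝ) + 5) ∧ 1 / ((n : ℝ) + 5) < 1 / 4 := fun n =>
    ⟨by positivity, one_div_lt_one_div_of_lt (by norm_num) (by linarith [n.cast_nonneg (α := ℝ)])⟩
  choose g β c hg hgβ hβ hβ1 hg0 hg1 hc0 hc1 using fun n =>
    exists_smooth_truncation (hδ n).1 (hδ n).2
  have hδlim : Tendsto (fun n : ℕ => 2 * (1 / ((n : ℝ) + 5))) atTop (𝓝 0) := by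
    have h1 : Tendsto (fun n : ℕ => (n : ℝ) + 5) atTop atTop :=
      tendsto_atTop_add_const_right _ _ tendsto_natCast_atTop_atTop
    simpa using (tendsto_const_nhds (x := (1 : ℝ)).div_atTop h1).const_mul (2 : ℝ)
  have hfd : Measurable (fderiv ℝ H) := measurable_fderiv ℝ H
  have hβm : ∀ n, Measurable (β n) := fun n => by
    rw [← funext fun s => (hgβ n s).deriv]
    exact measurable_deriv _
  have hmeas : ∀ n, Measurable fun x => ENNReal.ofReal (β n (H x) * ‖fderiv ℝ H x‖ ^ 2) := fun n =>
    (((hβm n).comp h.continuous.measurable).mul (hfd.norm.pow_const 2)).ennreal_ofReal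
  -- Where `0 < H x < 1` the factor `β n (H x)` is eventually `1`. Where `H x` is `0` or `1`, the
  -- point is a global extremum, so the derivative vanishes and the factor does not matter.
  have hlim : ∀ x, ENNReal.ofReal (‖fderiv ℝ H x‖ ^ 2) =
      liminf (fun n => ENNReal.ofReal (β n (H x) * ‖fderiv ℝ H x‖ ^ 2)) atTop := fun x => by
    refine (Tendsto.liminf_eq (tendsto_const_nhds.congr' ?_)).symm
    rcases (h.nonneg hd x).eq_or_lt with h0 | h0
    · have hmin : IsLocalMin H x := Eventually.of_forall fun y => by
        rw [← h0]; exact h.nonneg hd y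
      simp [hmin.fderiv_eq_zero]
    rcases (h.le_one hd x).eq_or_lt with h1 | h1
    · have hmax : IsLocalMax H x := Eventually.of_forall fun y => by
        rw [h1]; exact h.le_one hd y
      simp [hmax.fderiv_eq_zero]
    have hev := hδlim.eventually_lt_const (lt_min h0 (sub_pos.2 h1))
    filter_upwards [hev] with n hn
    rw [hβ1 n (H x) ⟨(hn.trans_le (min_le_left _ _)).le, ?_⟩, one_mul]
    linarith [hn.trans_le (min_le_right _ _)]
  calc ∫⁻ x, ENNReal.ofReal (‖fderiv ℝ H x‖ ^ 2)
      = ∫⁻ x, liminf (fun n => ENNReal.ofReal (β n (H x) * ‖fderiv ℝ H x‖ ^ 2)) atTop :=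
        lintegral_congr hlim
    _ ≤ liminf (fun n => ∫⁻ x, ENNReal.ofReal (β n (H x) * ‖fderiv ℝ H x‖ ^ 2)) atTop :=
        lintegral_liminf_le hmeas
    _ ≤ _ := liminf_le_of_le (by isBoundedDefault) fun b hb => by
        obtain ⟨n, hn⟩ := hb.exists
        exact hn.trans (h.lintegral_truncation_le hd hK hφ hφc hφ1 (hδ n).1 (hg n) (hgβ n) (hβ n)
          (hg0 n) (hg1 n) (hc0 n) (hc1 n))

theorem partialDeriv_comp_rescale {d : ℕ} {f : Space d → ℝ} (hf : Differentiable ℝ f) (r : ℝ)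
    (x₀ : Space d) (j : Fin d) :
    partialDeriv j (fun x => f (r • (x - x₀))) = fun x => r * partialDeriv j f (r • (x - x₀)) := by
  funext x
  have h1 : HasFDerivAt (fun x : Space d => r • (x - x₀)) (r • ContinuousLinearMap.id ℝ (Space d)) x :=
    ((hasFDerivAt_id x).sub_const x₀).const_smul r
  have := (hf (r • (x - x₀))).hasFDerivAt.comp x h1
  refine (congrArg (fun L => L (EuclideanSpace.basisFun (Fin d) ℝ j)) this.fderiv).trans ?_
  simp [partialDeriv]

theorem integral_comp_rescale {d : ℕ} (f : Space d → ℝ) {r : ℝ} (hr : 0 < r) (x₀ : Space d) :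
    ∫ x, f (r⁻¹ • (x - x₀)) = r ^ d * ∫ x, f x := by
  rw [integral_sub_right_eq_self (fun x => f (r⁻¹ • x)) x₀, Measure.integral_comp_inv_smul]
  simp [abs_of_pos hr]

/-- The capacity of a compact set in a closed ball of radius `a` is at most a multiple of
`a ^ (d - 2)`. -/
theorem exists_capacity_le {d : ℕ} (hd : 3 ≤ d) :
    ∃ C : ℝ, 0 ≤ C ∧ ∀ (K : Set (Space d)) (x₀ : Space d) (a : ℝ), IsCompact K → K.Nonempty →
      K ⊆ Metric.closedBall x₀ a → capacity K ≤ C * a ^ (d - 2) := by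
  -- The inner radius `2` exceeds `1`, so the bump rescaled by `r > a` equals `1` on a neighbourhood
  -- of `K`, as Green's formula requires.
  let χ : ContDiffBump (0 : Space d) := ⟨2, 3, by norm_num, by norm_num⟩
  have hχ : ContDiff ℝ ∞ χ := χ.contDiff
  have hχd : Differentiable ℝ χ := hχ.differentiable (by simp)
  have hχd' : ∀ j, Differentiable ℝ (partialDeriv j χ) := fun j =>
    (contDiff_partialDeriv (m := 1) (n := ⊤) hχ (by simp) j).differentiable (by norm_num)
  set C₁ := ∫ x, |∑ j, partialDeriv j (partialDeriv j χ) x| with hC₁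
  set C₂ := dirichletEnergy χ with hC₂
  have hC₁0 : 0 ≤ C₁ := integral_nonneg fun x => abs_nonneg _
  have hC₂0 : 0 ≤ C₂ := integral_nonneg fun x => sq_nonneg _
  refine ⟨max C₁ C₂, le_max_of_le_left hC₁0, fun K x₀ a hK hKne hKa => ?_⟩
  have ha : 0 ≤ a := by
    obtain ⟨y, hy⟩ := hKne
    exact dist_nonneg.trans (hKa hy)
  have hpow : ∀ r : ℝ, 0 < r → r⁻¹ ^ 2 * r ^ d = r ^ (d - 2) := fun r hr => by
    obtain ⟨k, rfl⟩ : ∃ k, d = k + 2 := ⟨d - 2, by omega⟩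
    rw [Nat.add_sub_cancel, pow_add]
    field_simp
  -- Scaling needs a positive radius, while `a` vanishes when `K` is a point. The estimate is proved
  -- for `r > a`, and then `r` decreases to `a`.
  have hr : ∀ r, a < r → capacity K ≤ max C₁ C₂ * r ^ (d - 2) := fun r har => by
    have hr0 : 0 < r := ha.trans_lt har
    set φ : Space d → ℝ := fun x => χ (r⁻¹ • (x - x₀)) with hφdef
    have hφ : ContDiff ℝ ∞ φ := hχ.comp (by fun_prop)
    have hφc : HasCompactSupport φ := by
      refine HasCompactSupport.intro (isCompact_closedBall x₀ (3 * r)) fun x hx => ?_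
      refine χ.zero_of_le_dist ?_
      show 3 ≤ _
      rw [Metric.mem_closedBall, not_le, dist_eq_norm] at hx
      rw [dist_zero_right, norm_smul, norm_inv, Real.norm_of_nonneg hr0.le, inv_mul_eq_div,
        le_div_iff₀ hr0]
      exact hx.le
    have hφone : ∀ x, dist x x₀ ≤ 2 * r → φ x = 1 := fun x hx => by
      refine χ.one_of_mem_closedBall ?_
      rw [mem_closedBall_zero_iff]
      show _ ≤ 2
      rw [norm_smul, norm_inv, Real.norm_of_nonneg hr0.le, inv_mul_eq_div, div_le_iff₀ hr0,
        ← dist_eq_norm]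
      exact hx
    have hd1 : ∀ j, partialDeriv j φ = fun x => r⁻¹ * partialDeriv j χ (r⁻¹ • (x - x₀)) := fun j =>
      partialDeriv_comp_rescale hχd _ _ j
    unfold capacity
    split_ifs with hH
    · have hφ1 : ∀ x ∈ K, φ =ᶠ[𝓝 x] fun _ => 1 := fun x hx => by
        have : Metric.ball x₀ (2 * r) ∈ 𝓝 x := Metric.isOpen_ball.mem_nhds
          (lt_of_le_of_lt (b := a) (hKa hx) (by linarith))
        filter_upwards [this] with y hy using hφone y (Metric.mem_ball.1 hy).le
      have h1 := hH.choose_spec.lintegral_energy_le (by omega) hK.isClosed hφ hφc hφ1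
      have h2 : ∫ x, |∑ j, partialDeriv j (partialDeriv j φ) x| = C₁ * r ^ (d - 2) := by
        have : ∀ x, |∑ j, partialDeriv j (partialDeriv j φ) x| =
            r⁻¹ ^ 2 * |∑ j, partialDeriv j (partialDeriv j χ) (r⁻¹ • (x - x₀))| := fun x => by
          have h3 : ∀ j, partialDeriv j (partialDeriv j φ) x =
              r⁻¹ ^ 2 * partialDeriv j (partialDeriv j χ) (r⁻¹ • (x - x₀)) := fun j => by
            rw [hd1]
            have h5 : Differentiable ℝ (fun x => partialDeriv j χ (r⁻¹ • (x - x₀))) :=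
              (hχd' j).comp (by fun_prop)
            have h4 : partialDeriv j (fun x => r⁻¹ * partialDeriv j χ (r⁻¹ • (x - x₀))) x =
                r⁻¹ * partialDeriv j (fun x => partialDeriv j χ (r⁻¹ • (x - x₀))) x :=
              congrArg (fun L => L (EuclideanSpace.basisFun (Fin d) ℝ j))
                ((h5 x).hasFDerivAt.const_mul r⁻¹).fderiv
            rw [h4, partialDeriv_comp_rescale (hχd' j)]
            ring
          rw [Finset.sum_congr rfl fun j _ => h3 j, ← Finset.mul_sum, abs_mul, abs_of_nonneg]
          positivity
        rw [integral_congr_ae (Eventually.of_forall this), integral_const_mul,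
          integral_comp_rescale (fun x => |∑ j, partialDeriv j (partialDeriv j χ) x|) hr0,
          ← mul_assoc, hpow r hr0, mul_comm]
      have h3 : dirichletEnergy hH.choose ≤ C₁ * r ^ (d - 2) := by
        rw [h2] at h1
        rw [dirichletEnergy, integral_eq_lintegral_of_nonneg_ae
          (Eventually.of_forall fun x => sq_nonneg _)
          ((measurable_fderiv ℝ hH.choose).norm.pow_const 2).aestronglyMeasurable]
        exact ENNReal.toReal_le_of_le_ofReal (by positivity) h1
      exact h3.trans (mul_le_mul_of_nonneg_right (le_max_left _ _) (by positivity))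
    · have h2 : dirichletEnergy φ = C₂ * r ^ (d - 2) := by
        have : ∀ x, ‖fderiv ℝ φ x‖ ^ 2 = r⁻¹ ^ 2 * ‖fderiv ℝ χ (r⁻¹ • (x - x₀))‖ ^ 2 := fun x => by
          rw [norm_fderiv_sq, norm_fderiv_sq, Finset.mul_sum]
          refine Finset.sum_congr rfl fun j _ => ?_
          rw [hd1]; ring
        rw [dirichletEnergy, integral_congr_ae (Eventually.of_forall this), integral_const_mul,
          integral_comp_rescale (fun x => ‖fderiv ℝ χ x‖ ^ 2) hr0,
          ← mul_assoc, hpow r hr0, mul_comm, hC₂, dirichletEnergy]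
      refine le_trans (csInf_le (a := dirichletEnergy φ) ⟨0, ?_⟩ ⟨φ, hφ, hφc, fun x hx => ?_, rfl⟩)
        (h2.le.trans (mul_le_mul_of_nonneg_right (le_max_right _ _) (by positivity)))
      · rintro e ⟨ψ, -, -, -, rfl⟩
        exact integral_nonneg fun x => sq_nonneg _
      · exact (hφone x (le_trans (b := a) (hKa hx) (by linarith))).ge
  have hlim : Tendsto (fun r : ℝ => max C₁ C₂ * r ^ (d - 2)) (𝓝[>] a)
      (𝓝 (max C₁ C₂ * a ^ (d - 2))) :=
    (Continuous.tendsto (by fun_prop) a).mono_left nhdsWithin_le_nhds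
  exact ge_of_tendsto hlim (by filter_upwards [self_mem_nhdsWithin] with r h using hr r h)

theorem capacity_nonneg {d : ℕ} (K : Set (Space d)) : 0 ≤ capacity K := by
  unfold capacity
  split_ifs
  · exact integral_nonneg fun x => sq_nonneg _
  · refine Real.sInf_nonneg ?_
    rintro e ⟨ψ, -, -, -, rfl⟩
    exact integral_nonneg fun x => sq_nonneg _

/-! ### Compactness of the embedding of `H¹₀` into `L²` -/

/-- Jensen's inequality for the square, from the monotonicity of `L^p` norms under a probability
measure. -/
theorem enorm_integral_sq_le {Z : Type*} [MeasurableSpace Z] (P : Measure Z)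
    [IsProbabilityMeasure P] {f : Z → ℝ} (hf : AEStronglyMeasurable f P) :
    ‖∫ z, f z ∂P‖ₑ ^ 2 ≤ ∫⁻ z, ‖f z‖ₑ ^ 2 ∂P := by
  have h1 : ‖∫ z, f z ∂P‖ₑ ≤ eLpNorm f 2 P := by
    refine (enorm_integral_le_lintegral_enorm f).trans ?_
    rw [← eLpNorm_one_eq_lintegral_enorm]
    exact eLpNorm_le_eLpNorm_of_exponent_le (by norm_num) hf
  have h2 : eLpNorm f 2 P ^ 2 = ∫⁻ z, ‖f z‖ₑ ^ 2 ∂P := by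
    have := eLpNorm_nnreal_pow_eq_lintegral (μ := P) (f := f) (p := 2) (by norm_num)
    simpa using this
  rw [← h2]
  gcongr

/-- The increment is the integral of the derivative along the segment from `x` to `x + z`. Jensen's
inequality in the segment parameter, Tonelli's theorem and translation invariance give the bound. -/
theorem lintegral_enorm_translate_sub_sq_le {d : ℕ} {φ : Space d → ℝ} (hφ : ContDiff ℝ 1 φ)
    (z : Space d) :
    ∫⁻ x, ‖φ (x + z) - φ x‖ₑ ^ 2 ≤ ‖z‖ₑ ^ 2 * ∫⁻ x, ‖fderiv ℝ φ x‖ₑ ^ 2 := by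
  have hD : Continuous (fderiv ℝ φ) := hφ.continuous_fderiv (by norm_num)
  let P : Measure ℝ := volume.restrict (Ioc 0 1)
  have hP : IsProbabilityMeasure P := ⟨by simp [P]⟩
  have hpt : ∀ x, ‖φ (x + z) - φ x‖ₑ ^ 2 ≤
      ∫⁻ t, ‖z‖ₑ ^ 2 * ‖fderiv ℝ φ (x + t • z)‖ₑ ^ 2 ∂P := fun x => by
    have hl : ∀ t : ℝ, HasDerivAt (fun s : ℝ => x + s • z) z t := fun t => by
      simpa using ((hasDerivAt_id t).smul_const z).const_add x
    have hc : Continuous fun t : ℝ => fderiv ℝ φ (x + t • z) z :=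
      (hD.comp (by fun_prop)).clm_apply continuous_const
    have h1 : φ (x + z) - φ x = ∫ t, fderiv ℝ φ (x + t • z) z ∂P := by
      have := intervalIntegral.integral_eq_sub_of_hasDerivAt (a := 0) (b := 1)
        (f := fun t : ℝ => φ (x + t • z)) (f' := fun t => fderiv ℝ φ (x + t • z) z)
        (fun t _ => ((hφ.differentiable (by norm_num)) _).hasFDerivAt.comp_hasDerivAt t (hl t))
        (hc.intervalIntegrable _ _)
      rw [intervalIntegral.integral_of_le zero_le_one] at this
      simpa using this.symm
    rw [h1]
    refine (enorm_integral_sq_le P hc.aestronglyMeasurable).trans (lintegral_mono fun t => ?_)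
    rw [← mul_pow, mul_comm]
    gcongr
    exact ContinuousLinearMap.le_opENorm _ _
  calc ∫⁻ x, ‖φ (x + z) - φ x‖ₑ ^ 2
      ≤ ∫⁻ x, ∫⁻ t, ‖z‖ₑ ^ 2 * ‖fderiv ℝ φ (x + t • z)‖ₑ ^ 2 ∂P := lintegral_mono hpt
    _ = ∫⁻ t, (∫⁻ x, ‖z‖ₑ ^ 2 * ‖fderiv ℝ φ (x + t • z)‖ₑ ^ 2) ∂P := by
        have : Continuous fun p : Space d × ℝ => fderiv ℝ φ (p.1 + p.2 • z) := by fun_prop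
        exact lintegral_lintegral_swap
          ((this.measurable.enorm.pow_const 2).const_mul (‖z‖ₑ ^ 2)).aemeasurable
    _ = ∫⁻ _, (‖z‖ₑ ^ 2 * ∫⁻ x, ‖fderiv ℝ φ x‖ₑ ^ 2) ∂P := by
        refine lintegral_congr fun t => ?_
        rw [lintegral_const_mul' _ _ (by simp),
          lintegral_add_right_eq_self (fun x => ‖fderiv ℝ φ x‖ₑ ^ 2) (t • z)]
    _ = _ := by simp

/-- The average of the translates of `φ` with respect to a probability measure. -/
def mollify {d : ℕ} (P : Measure (Space d)) (φ : Space d → ℝ) (x : Space d) : ℝ :=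
  ∫ z, φ (x + z) ∂P

theorem integrable_comp_add {d : ℕ} (P : Measure (Space d)) [IsFiniteMeasure P]
    {φ : Space d → ℝ} (hφ : Continuous φ) (hc : HasCompactSupport φ) (x : Space d) :
    Integrable (fun z => φ (x + z)) P := by
  obtain ⟨C, hC⟩ := hφ.bounded_above_of_compact_support hc
  exact Integrable.of_bound (by fun_prop) C (Eventually.of_forall fun z => hC _)

theorem mollify_sub {d : ℕ} (P : Measure (Space d)) [IsFiniteMeasure P] {φ ψ : Space d → ℝ}
    (hφ : Continuous φ) (hφc : HasCompactSupport φ) (hψ : Continuous ψ)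
    (hψc : HasCompactSupport ψ) (x : Space d) :
    mollify P (fun y => φ y - ψ y) x = mollify P φ x - mollify P ψ x :=
  integral_sub (integrable_comp_add P hφ hφc x) (integrable_comp_add P hψ hψc x)

section Mollify

variable {d : ℕ} (P : Measure (Space d)) [IsProbabilityMeasure P] {φ : Space d → ℝ}

theorem enorm_mollify_sq_le (hφ : Continuous φ) {c : ℝ≥0∞} (hP : P ≤ c • volume) (x : Space d) :
    ‖mollify P φ x‖ₑ ^ 2 ≤ c * ∫⁻ y, ‖φ y‖ₑ ^ 2 := by
  refine (enorm_integral_sq_le P (by fun_prop)).trans ((lintegral_mono' hP le_rfl).trans ?_)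
  rw [lintegral_smul_measure, lintegral_add_left_eq_self (fun y => ‖φ y‖ₑ ^ 2) x, smul_eq_mul]

/-- Mollified functions are Lipschitz with a constant depending only on `c` and the Dirichlet
integral, so their values on a fine finite net control them everywhere. -/
theorem enorm_mollify_sub_mollify_sq_le (hφ : ContDiff ℝ 1 φ) (hc : HasCompactSupport φ)
    {c : ℝ≥0∞} (hP : P ≤ c • volume) (x y : Space d) :
    ‖mollify P φ x - mollify P φ y‖ₑ ^ 2 ≤
      c * (‖x - y‖ₑ ^ 2 * ∫⁻ y, ‖fderiv ℝ φ y‖ₑ ^ 2) := by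
  have hφc := hφ.continuous
  rw [mollify, mollify, ← integral_sub (integrable_comp_add P hφc hc x)
    (integrable_comp_add P hφc hc y)]
  refine (enorm_integral_sq_le P (by fun_prop)).trans ((lintegral_mono' hP le_rfl).trans ?_)
  rw [lintegral_smul_measure, smul_eq_mul]
  gcongr
  have : ∀ z, ‖φ (x + z) - φ (y + z)‖ₑ ^ 2 =
      (fun u => ‖φ (u + (x - y)) - φ u‖ₑ ^ 2) (y + z) := fun z => by
    simp only
    congr 4
    abel
  rw [lintegral_congr this, lintegral_add_left_eq_self (fun u => ‖φ (u + (x - y)) - φ u‖ₑ ^ 2) y]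
  exact lintegral_enorm_translate_sub_sq_le hφ _

theorem lintegral_enorm_mollify_sub_sq_le (hφ : ContDiff ℝ 1 φ) (hc : HasCompactSupport φ)
    {h : ℝ≥0∞} (hP : ∀ᵐ z ∂P, ‖z‖ₑ ≤ h) :
    ∫⁻ x, ‖mollify P φ x - φ x‖ₑ ^ 2 ≤ h ^ 2 * ∫⁻ y, ‖fderiv ℝ φ y‖ₑ ^ 2 := by
  have hφc := hφ.continuous
  have hpt : ∀ x, ‖mollify P φ x - φ x‖ₑ ^ 2 ≤ ∫⁻ z, ‖φ (x + z) - φ x‖ₑ ^ 2 ∂P := fun x => by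
    have : mollify P φ x - φ x = ∫ z, (φ (x + z) - φ x) ∂P := by
      rw [integral_sub (integrable_comp_add P hφc hc x) (integrable_const _), mollify]
      simp
    rw [this]
    exact enorm_integral_sq_le P (by fun_prop)
  calc ∫⁻ x, ‖mollify P φ x - φ x‖ₑ ^ 2
      ≤ ∫⁻ x, ∫⁻ z, ‖φ (x + z) - φ x‖ₑ ^ 2 ∂P := lintegral_mono hpt
    _ = ∫⁻ z, (∫⁻ x, ‖φ (x + z) - φ x‖ₑ ^ 2) ∂P :=
        lintegral_lintegral_swap (Continuous.measurable (by
          unfold Function.uncurry; fun_prop)).aemeasurable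
    _ ≤ ∫⁻ _, (h ^ 2 * ∫⁻ y, ‖fderiv ℝ φ y‖ₑ ^ 2) ∂P := by
        refine lintegral_mono_ae ?_
        filter_upwards [hP] with z hz
        refine (lintegral_enorm_translate_sub_sq_le hφ z).trans ?_
        gcongr
    _ = _ := by simp

end Mollify

/-- The uniform distribution on the ball of radius `h`, with `c` the reciprocal of its volume. -/
theorem exists_mollifier (d : ℕ) {h : ℝ} (hh : 0 < h) :
    ∃ P : Measure (Space d), IsProbabilityMeasure P ∧ (∀ᵐ z ∂P, ‖z‖ₑ ≤ ENNReal.ofReal h) ∧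
      ∃ c : ℝ, 0 < c ∧ P ≤ ENNReal.ofReal c • volume := by
  have h0 : volume (Metric.ball (0 : Space d) h) ≠ 0 :=
    (Metric.measure_ball_pos volume _ hh).ne'
  have ht : volume (Metric.ball (0 : Space d) h) ≠ ⊤ := measure_ball_lt_top.ne
  refine ⟨ProbabilityTheory.cond volume (Metric.ball 0 h),
    ProbabilityTheory.cond_isProbabilityMeasure_of_finite h0 ht, ?_,
    (volume (Metric.ball (0 : Space d) h))⁻¹.toReal, ?_, ?_⟩
  · rw [ProbabilityTheory.cond]
    refine Measure.ae_smul_measure ?_ _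
    filter_upwards [ae_restrict_mem Metric.isOpen_ball.measurableSet] with z hz
    rw [← ofReal_norm]
    exact ENNReal.ofReal_le_ofReal (by simpa using (mem_ball_zero_iff.1 hz).le)
  · exact ENNReal.toReal_pos (ENNReal.inv_ne_zero.2 ht) (ENNReal.inv_ne_top.2 h0)
  · rw [ENNReal.ofReal_toReal (ENNReal.inv_ne_top.2 h0), ProbabilityTheory.cond]
    gcongr
    exact Measure.restrict_le_self

theorem lintegral_enorm_sq_eq {d : ℕ} {F : Type*} [NormedAddCommGroup F] {f : Space d → F}
    (hf : Continuous f) (hc : HasCompactSupport f) :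
    ∫⁻ x, ‖f x‖ₑ ^ 2 = ENNReal.ofReal (∫ x, ‖f x‖ ^ 2) := by
  rw [ofReal_integral_eq_lintegral_ofReal]
  · refine lintegral_congr fun x => ?_
    rw [ENNReal.ofReal_pow (norm_nonneg _), ofReal_norm]
  · have h2 : HasCompactSupport fun x => ‖f x‖ ^ 2 := hc.norm.mono fun x hx => by
      rw [Function.mem_support] at hx ⊢
      exact fun h => hx (by rw [h]; norm_num)
    exact (hf.norm.pow 2).integrable_of_hasCompactSupport h2
  · exact Eventually.of_forall fun x => sq_nonneg _

/-- If the averages of `w` are small on a fine net of `Ω`, then `w` is small in `L²`. -/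
theorem integral_sq_le_of_mollify_le {d : ℕ} {Ω : Set (Space d)} (hΩo : IsOpen Ω)
    (hΩ : Bornology.IsBounded Ω) (P : Measure (Space d)) [IsProbabilityMeasure P] {h c ρ θ G : ℝ} (hh : 0 ≤ h) (hc : 0 ≤ c)
    (hρ : 0 ≤ ρ) (hθ : 0 ≤ θ) (hG : 0 ≤ G)
    (hPh : ∀ᵐ z ∂P, ‖z‖ₑ ≤ ENNReal.ofReal h) (hPc : P ≤ ENNReal.ofReal c • volume)
    {N : Set (Space d)} (hN : ∀ x ∈ Ω, ∃ y ∈ N, ‖x - y‖ ≤ ρ)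
    {w : Space d → ℝ} (hw : ContDiff ℝ 1 w) (hwc : HasCompactSupport w) (hwΩ : tsupport w ⊆ Ω)
    (hwG : ∫ x, ‖fderiv ℝ w x‖ ^ 2 ≤ G) (hwN : ∀ y ∈ N, |mollify P w y| ≤ θ) :
    ∫ x, w x ^ 2 ≤ 2 * (h ^ 2 * G) + 2 * ((2 * (c * (ρ ^ 2 * G)) + 2 * θ ^ 2) * volume.real Ω) := by
  have hfd : ∫⁻ y, ‖fderiv ℝ w y‖ₑ ^ 2 ≤ ENNReal.ofReal G := by
    rw [lintegral_enorm_sq_eq (hw.continuous_fderiv (by norm_num)) (hwc.fderiv ℝ)]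
    exact ENNReal.ofReal_le_ofReal hwG
  have hΩt : volume Ω ≠ ⊤ := hΩ.measure_lt_top.ne
  have habs : ∀ a b : ℝ, ‖a‖ₑ ^ 2 ≤
      ENNReal.ofReal 2 * ‖b - a‖ₑ ^ 2 + ENNReal.ofReal 2 * ‖b‖ₑ ^ 2 := fun a b => by
    have hsq : ∀ t : ℝ, ‖t‖ₑ ^ 2 = ENNReal.ofReal (t ^ 2) := fun t => by
      rw [Real.enorm_eq_ofReal_abs, ← ENNReal.ofReal_pow (abs_nonneg t), sq_abs]
    rw [hsq, hsq, hsq, ← ENNReal.ofReal_mul (by norm_num),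
      ← ENNReal.ofReal_mul (by norm_num), ← ENNReal.ofReal_add (by positivity) (by positivity)]
    refine ENNReal.ofReal_le_ofReal ?_
    nlinarith [sq_nonneg (2 * b - a)]
  -- Compare with a net point `y` within `ρ`: the mollification is at most `θ` at `y`, and its
  -- squared change from `y` to `x` is at most `c ρ² G`.
  have hsup : ∀ x ∈ Ω, ‖mollify P w x‖ₑ ^ 2 ≤
      ENNReal.ofReal (2 * (c * (ρ ^ 2 * G)) + 2 * θ ^ 2) := fun x hx => by
    obtain ⟨y, hy, hxy⟩ := hN x hx
    have hxy' : ‖y - x‖ₑ ≤ ENNReal.ofReal ρ := by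
      rw [← ofReal_norm, norm_sub_rev]
      exact ENNReal.ofReal_le_ofReal hxy
    have hy' : ‖mollify P w y‖ₑ ≤ ENNReal.ofReal θ := by
      rw [← ofReal_norm]
      exact ENNReal.ofReal_le_ofReal (hwN y hy)
    calc ‖mollify P w x‖ₑ ^ 2
        ≤ ENNReal.ofReal 2 * ‖mollify P w y - mollify P w x‖ₑ ^ 2 + ENNReal.ofReal 2 * ‖mollify P w y‖ₑ ^ 2 := habs _ _
      _ ≤ ENNReal.ofReal 2 * (ENNReal.ofReal c * (ENNReal.ofReal ρ ^ 2 * ENNReal.ofReal G)) +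
            ENNReal.ofReal 2 * ENNReal.ofReal θ ^ 2 := by
          gcongr
          refine (enorm_mollify_sub_mollify_sq_le P hw hwc hPc y x).trans ?_
          gcongr
      _ = _ := by
          rw [← ENNReal.ofReal_pow hρ,
            ← ENNReal.ofReal_pow hθ, ← ENNReal.ofReal_mul (by positivity),
            ← ENNReal.ofReal_mul (by positivity), ← ENNReal.ofReal_mul (by positivity),
            ← ENNReal.ofReal_mul (by positivity), ← ENNReal.ofReal_add (by positivity) (by positivity)]
  have hmain : ∫⁻ x, ‖w x‖ₑ ^ 2 ≤ ENNReal.ofReal 2 * (ENNReal.ofReal h ^ 2 * ENNReal.ofReal G) +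
      ENNReal.ofReal 2 * (ENNReal.ofReal (2 * (c * (ρ ^ 2 * G)) + 2 * θ ^ 2) * volume Ω) := by
    have hm : Measurable fun x => ‖mollify P w x - w x‖ₑ ^ 2 := by
      have hu : StronglyMeasurable fun p : Space d × Space d => w (p.1 + p.2) :=
        (hw.continuous.comp (by fun_prop)).stronglyMeasurable
      have : Measurable (mollify P w) := hu.integral_prod_right'.measurable
      exact ((this.sub hw.continuous.measurable).enorm).pow_const 2
    calc ∫⁻ x, ‖w x‖ₑ ^ 2 = ∫⁻ x in Ω, ‖w x‖ₑ ^ 2 := by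
          refine (setLIntegral_eq_of_support_subset fun x hx => ?_).symm
          refine hwΩ (subset_tsupport _ ?_)
          rw [Function.mem_support] at hx ⊢
          contrapose! hx
          simp [hx]
      _ ≤ ∫⁻ x in Ω, (ENNReal.ofReal 2 * ‖mollify P w x - w x‖ₑ ^ 2 + ENNReal.ofReal 2 * ‖mollify P w x‖ₑ ^ 2) :=
          lintegral_mono fun x => habs _ _
      _ = ENNReal.ofReal 2 * (∫⁻ x in Ω, ‖mollify P w x - w x‖ₑ ^ 2) + ENNReal.ofReal 2 * ∫⁻ x in Ω, ‖mollify P w x‖ₑ ^ 2 := by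
          rw [lintegral_add_left (hm.const_mul _), lintegral_const_mul _ hm,
            lintegral_const_mul' _ _ (by simp)]
      _ ≤ ENNReal.ofReal 2 * (ENNReal.ofReal h ^ 2 * ENNReal.ofReal G) +
          ENNReal.ofReal 2 * ∫⁻ x in Ω, ENNReal.ofReal (2 * (c * (ρ ^ 2 * G)) + 2 * θ ^ 2) := by
          gcongr ENNReal.ofReal 2 * ?_ + ENNReal.ofReal 2 * ?_
          · refine (setLIntegral_le_lintegral _ _).trans
              ((lintegral_enorm_mollify_sub_sq_le P hw hwc hPh).trans ?_)
            gcongr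
          · exact setLIntegral_mono' hΩo.measurableSet hsup
      _ = _ := by simp
  rw [lintegral_enorm_sq_eq hw.continuous hwc] at hmain
  have : ENNReal.ofReal (∫ x, w x ^ 2) ≤ ENNReal.ofReal
      (2 * (h ^ 2 * G) + 2 * ((2 * (c * (ρ ^ 2 * G)) + 2 * θ ^ 2) * volume.real Ω)) := by
    simp only [Real.norm_eq_abs, sq_abs] at hmain
    refine hmain.trans_eq ?_
    rw [← ENNReal.ofReal_toReal hΩt,
      ← ENNReal.ofReal_pow hh, ← ENNReal.ofReal_mul (by positivity),
      ← ENNReal.ofReal_mul (by positivity), ← ENNReal.ofReal_mul (by positivity),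
      ← ENNReal.ofReal_mul (by positivity), ← ENNReal.ofReal_add (by positivity) (by positivity)]
    rfl
  exact (ENNReal.ofReal_le_ofReal_iff (by positivity)).1 this

/-! ### Test functions with the norm of `H¹₀(Ω)` -/

section TestFunctions

variable {d : ℕ} {Ω : TopologicalSpace.Opens (Space d)}

theorem testFunction_contDiff (φ : 𝓓(Ω, ℝ)) (n : ℕ) : ContDiff ℝ n φ :=
  contDiff_infty.1 φ.contDiff n

theorem continuous_partialDeriv_testFunction (φ : 𝓓(Ω, ℝ)) (j : Fin d) :
    Continuous (partialDeriv j φ) :=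
  (contDiff_partialDeriv (m := 0) (n := 1) (testFunction_contDiff φ 1) (by norm_num) j).continuous

theorem integrable_mul_testFunction {f : Space d → ℝ} (hf : Continuous f) (φ : 𝓓(Ω, ℝ)) :
    Integrable fun x => f x * φ x :=
  (hf.mul φ.continuous).integrable_of_hasCompactSupport φ.hasCompactSupport.mul_left

theorem integrable_mul_partialDeriv_testFunction {f : Space d → ℝ} (hf : Continuous f)
    (φ : 𝓓(Ω, ℝ)) (j : Fin d) : Integrable fun x => f x * partialDeriv j φ x :=
  (hf.mul (continuous_partialDeriv_testFunction φ j)).integrable_of_hasCompactSupport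
    (hasCompactSupport_partialDeriv φ.hasCompactSupport j).mul_left

theorem integrable_testFunction_sq (φ : 𝓓(Ω, ℝ)) : Integrable fun x => φ x ^ 2 := by
  simpa only [sq] using integrable_mul_testFunction φ.continuous φ

theorem integrable_norm_fderiv_testFunction_sq (φ : 𝓓(Ω, ℝ)) :
    Integrable fun x => ‖fderiv ℝ φ x‖ ^ 2 := by
  simp only [norm_fderiv_sq]
  simp only [sq]
  exact integrable_finsetSum _ fun j _ =>
    integrable_mul_partialDeriv_testFunction (continuous_partialDeriv_testFunction φ j) φ j

/-- The inner product of `H¹₀(Ω)`. -/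
def sobolevInner (φ ψ : 𝓓(Ω, ℝ)) : ℝ :=
  (∫ x, φ x * ψ x) + ∑ j, ∫ x, partialDeriv j φ x * partialDeriv j ψ x

theorem sobolevNorm_sq (φ : 𝓓(Ω, ℝ)) :
    sobolevNorm φ ^ 2 = (∫ x, φ x ^ 2) + ∫ x, ‖fderiv ℝ φ x‖ ^ 2 :=
  Real.sq_sqrt (add_nonneg (integral_nonneg fun _ => sq_nonneg _)
    (integral_nonneg fun _ => sq_nonneg _))

theorem sobolevNorm_nonneg (φ : 𝓓(Ω, ℝ)) : 0 ≤ sobolevNorm φ := Real.sqrt_nonneg _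

theorem sobolevNorm_sq_eq_inner (φ : 𝓓(Ω, ℝ)) : sobolevNorm φ ^ 2 = sobolevInner φ φ := by
  rw [sobolevNorm_sq, sobolevInner]
  simp only [norm_fderiv_sq]
  simp only [sq]
  rw [integral_finsetSum _ fun j _ =>
    integrable_mul_partialDeriv_testFunction (continuous_partialDeriv_testFunction φ j) φ j]

theorem partialDeriv_add_smul (φ ψ : 𝓓(Ω, ℝ)) (t : ℝ) (j : Fin d) (x : Space d) :
    partialDeriv j (φ + t • ψ : 𝓓(Ω, ℝ)) x = partialDeriv j φ x + t * partialDeriv j ψ x := by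
  have h1 := ((testFunction_contDiff φ 1).differentiable (by norm_num) x).hasFDerivAt
  have h2 := ((testFunction_contDiff ψ 1).differentiable (by norm_num) x).hasFDerivAt
  exact congrArg (fun L => L (EuclideanSpace.basisFun (Fin d) ℝ j))
    (h1.add (h2.const_mul t)).fderiv

theorem sobolevNorm_add_smul_sq (φ ψ : 𝓓(Ω, ℝ)) (t : ℝ) :
    sobolevNorm (φ + t • ψ) ^ 2 =
      sobolevNorm φ ^ 2 + 2 * t * sobolevInner φ ψ + t ^ 2 * sobolevNorm ψ ^ 2 := by
  have key : ∀ {f g : Space d → ℝ}, Integrable (fun x => f x * f x) →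
      Integrable (fun x => f x * g x) → Integrable (fun x => g x * g x) →
      ∫ x, (f x + t * g x) * (f x + t * g x) =
        (∫ x, f x * f x) + 2 * t * (∫ x, f x * g x) + t ^ 2 * ∫ x, g x * g x := by
    intro f g h1 h2 h3
    have h12 : Integrable fun x => f x * f x + 2 * t * (f x * g x) := h1.add (h2.const_mul _)
    rw [← integral_const_mul, ← integral_const_mul, ← integral_add h1 (h2.const_mul _),
      ← integral_add h12 (h3.const_mul _)]
    refine integral_congr_ae (Eventually.of_forall fun x => ?_)
    simp only
    ring
  simp only [sobolevNorm_sq_eq_inner, sobolevInner, partialDeriv_add_smul]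
  have e1 : ∀ x, (φ + t • ψ : 𝓓(Ω, ℝ)) x = φ x + t * ψ x := fun x => rfl
  simp only [e1]
  rw [key (integrable_mul_testFunction φ.continuous φ) (integrable_mul_testFunction φ.continuous ψ)
    (integrable_mul_testFunction ψ.continuous ψ), Finset.sum_congr rfl fun j _ => key
    (integrable_mul_partialDeriv_testFunction (continuous_partialDeriv_testFunction φ j) φ j)
    (integrable_mul_partialDeriv_testFunction (continuous_partialDeriv_testFunction φ j) ψ j)
    (integrable_mul_partialDeriv_testFunction (continuous_partialDeriv_testFunction ψ j) ψ j),
    Finset.sum_add_distrib, Finset.sum_add_distrib, ← Finset.mul_sum, ← Finset.mul_sum]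
  ring

theorem sobolevNorm_smul (φ : 𝓓(Ω, ℝ)) (t : ℝ) :
    sobolevNorm (t • φ) = |t| * sobolevNorm φ := by
  have h := sobolevNorm_add_smul_sq 0 φ t
  have h0 : sobolevNorm (0 : 𝓓(Ω, ℝ)) = 0 := by
    simp [sobolevNorm]
  have h1 : sobolevInner 0 φ = 0 := by
    have : ∀ j x, partialDeriv j (0 : Space d → ℝ) x = 0 := fun j x => by simp [partialDeriv]
    simp [sobolevInner, this]
  rw [zero_add, h0, h1] at h
  rw [← abs_of_nonneg (sobolevNorm_nonneg (t • φ)), ← abs_of_nonneg (sobolevNorm_nonneg φ),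
    ← abs_mul]
  exact (sq_eq_sq_iff_abs_eq_abs _ _).1 (by rw [h]; ring)

/-- The parallelogram identity. -/
theorem sobolevNorm_sub_le (φ ψ : 𝓓(Ω, ℝ)) (hφ : sobolevNorm φ ≤ 1) (hψ : sobolevNorm ψ ≤ 1) :
    sobolevNorm (φ - ψ) ≤ 2 := by
  have h1 := sobolevNorm_add_smul_sq φ ψ (-1)
  have h2 := sobolevNorm_add_smul_sq φ ψ 1
  rw [neg_one_smul, ← sub_eq_add_neg] at h1
  have h3 : sobolevNorm φ ^ 2 ≤ 1 := pow_le_one₀ (sobolevNorm_nonneg _) hφ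
  have h4 : sobolevNorm ψ ^ 2 ≤ 1 := pow_le_one₀ (sobolevNorm_nonneg _) hψ
  nlinarith [sq_nonneg (sobolevNorm (φ + (1 : ℝ) • ψ)), sobolevNorm_nonneg (φ - ψ)]

/-- Integration by parts, with `g = φ - Δφ`. Functionals represented by test functions are thus
bounded in `L²`. -/
theorem sobolevInner_eq (φ : 𝓓(Ω, ℝ)) : ∃ g : Space d → ℝ, Continuous g ∧ HasCompactSupport g ∧
    ∀ ψ : 𝓓(Ω, ℝ), sobolevInner φ ψ = ∫ x, g x * ψ x := by
  have hC : ∀ j, ContDiff ℝ 1 (partialDeriv j φ) := fun j =>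
    contDiff_partialDeriv (m := 1) (n := 2) (testFunction_contDiff φ 2) (by norm_num) j
  have hCC : ∀ j, Continuous (partialDeriv j (partialDeriv j φ)) := fun j =>
    (contDiff_partialDeriv (m := 0) (n := 1) (hC j) (by norm_num) j).continuous
  refine ⟨fun x => φ x - ∑ j, partialDeriv j (partialDeriv j φ) x, ?_, ?_, fun ψ => ?_⟩
  · exact φ.continuous.sub (continuous_finsetSum _ fun j _ => hCC j)
  · refine HasCompactSupport.intro φ.hasCompactSupport fun x hx => ?_
    rw [image_eq_zero_of_notMem_tsupport hx, Finset.sum_eq_zero fun j _ =>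
      image_eq_zero_of_notMem_tsupport fun h => hx (tsupport_partialDeriv_subset _ j
        (tsupport_partialDeriv_subset _ j h)), sub_zero]
  · simp only [sub_mul, Finset.sum_mul]
    rw [integral_sub (integrable_mul_testFunction φ.continuous ψ)
      (integrable_finsetSum _ fun j _ => integrable_mul_testFunction (hCC j) ψ),
      integral_finsetSum _ fun j _ => integrable_mul_testFunction (hCC j) ψ,
      sobolevInner, sub_eq_add_neg, ← Finset.sum_neg_distrib]
    congr 1
    refine Finset.sum_congr rfl fun j _ => ?_
    exact integral_mul_partialDeriv isOpen_univ (hC j).contDiffOn (testFunction_contDiff ψ 1)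
      (subset_univ _) ψ.hasCompactSupport j

theorem abs_le_mul_of_sobolevNorm_le {T : 𝓓(Ω, ℝ) → ℝ} (hs : ∀ (t : ℝ) φ, T (t • φ) = t * T φ)
    {N : ℝ} (hT : ∀ φ, sobolevNorm φ ≤ 1 → |T φ| ≤ N) {s : ℝ} (h0 : 0 < s) {φ : 𝓓(Ω, ℝ)}
    (hφ : sobolevNorm φ ≤ s) : |T φ| ≤ s * N := by
  have h1 : sobolevNorm (s⁻¹ • φ) ≤ 1 := by
    rw [sobolevNorm_smul, abs_of_pos (inv_pos.2 h0), inv_mul_eq_div, div_le_one h0]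
    exact hφ
  have h2 := hT _ h1
  rwa [hs, abs_mul, abs_of_pos (inv_pos.2 h0), inv_mul_eq_div, div_le_iff₀ h0, mul_comm] at h2

/-- A bounded functional on `H¹₀(Ω)` is, up to a small error, bounded in `L²`. -/
theorem exists_abs_le_add_mul_integral_sq (T : 𝓓(Ω, ℝ) →ₗ[ℝ] ℝ) {N : ℝ}
    (hT : ∀ φ, sobolevNorm φ ≤ 1 → |T φ| ≤ N) {η : ℝ} (hη : 0 < η) :
    ∃ C : ℝ, 0 ≤ C ∧ ∀ w, sobolevNorm w ≤ 1 → |T w| ≤ η + C * ∫ x, w x ^ 2 := by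
  have hN : 0 ≤ N := (abs_nonneg _).trans (hT 0 (by
    have := sobolevNorm_smul (0 : 𝓓(Ω, ℝ)) 0
    rw [zero_smul] at this
    rw [this]; simp))
  -- The functional minimised in the Riesz representation theorem. Test functions are not complete,
  -- but a near-minimiser `φ` is enough: its inner product approximates `T` on the unit ball.
  set J : 𝓓(Ω, ℝ) → ℝ := fun φ => sobolevNorm φ ^ 2 / 2 - T φ with hJ
  have hJb : BddBelow (range J) := by
    refine ⟨-(N ^ 2 / 2) - N, ?_⟩
    rintro _ ⟨φ, rfl⟩
    have h0 := sobolevNorm_nonneg φ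
    have := abs_le_mul_of_sobolevNorm_le (T := T) (fun t φ => by simp) hT
      (show 0 < sobolevNorm φ + 1 by linarith) (by linarith)
    simp only [hJ]
    nlinarith [le_abs_self (T φ), sq_nonneg (sobolevNorm φ - N)]
  obtain ⟨_, ⟨φ, rfl⟩, hφ⟩ := Real.lt_sInf_add_pos (s := range J) ⟨_, mem_range_self 0⟩
    (show 0 < η ^ 2 / 8 by positivity)
  have hmin : ∀ ψ, J φ - η ^ 2 / 8 ≤ J ψ := fun ψ => by
    have := csInf_le hJb (mem_range_self ψ)
    linarith
  obtain ⟨g, hg, hgc, hgφ⟩ := sobolevInner_eq φ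
  have hg2 : Integrable fun x => g x ^ 2 := by
    simp only [sq]
    exact (hg.mul hg).integrable_of_hasCompactSupport hgc.mul_left
  have hG : 0 ≤ ∫ x, g x ^ 2 := integral_nonneg fun _ => sq_nonneg _
  -- The weight in Young's inequality `|g w| ≤ κ g² + w² / (4 κ)`, chosen so that `κ ∫ g² ≤ η / 2`.
  set κ := η / (2 * ((∫ x, g x ^ 2) + 1)) with hκ
  have hκ0 : 0 < κ := by positivity
  refine ⟨1 / (4 * κ), by positivity, fun w hw => ?_⟩
  have hw1 : sobolevNorm w ^ 2 ≤ 1 := pow_le_one₀ (sobolevNorm_nonneg _) hw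
  -- Approximate minimality along the line `φ + t w`. Taking `t = ± η / 2` bounds the bracket by `η
  -- / 2`.
  have hvar : ∀ t : ℝ, -(η ^ 2 / 8) ≤ t * (sobolevInner φ w - T w) + t ^ 2 / 2 := fun t => by
    have := hmin (φ + t • w)
    simp only [hJ, sobolevNorm_add_smul_sq, map_add, map_smul, smul_eq_mul] at this
    nlinarith [sq_nonneg t]
  have h1 : |sobolevInner φ w - T w| ≤ η / 2 := by
    have ha := hvar (η / 2)
    have hb := hvar (-(η / 2))
    rw [abs_le]
    constructor <;> nlinarith
  have h2 : |sobolevInner φ w| ≤ η / 2 + 1 / (4 * κ) * ∫ x, w x ^ 2 := by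
    rw [hgφ, ← Real.norm_eq_abs]
    have hint : Integrable fun x => κ * g x ^ 2 + 1 / (4 * κ) * w x ^ 2 :=
      (hg2.const_mul _).add ((integrable_testFunction_sq w).const_mul _)
    refine (norm_integral_le_of_norm_le hint (Eventually.of_forall fun x => ?_)).trans ?_
    · rw [Real.norm_eq_abs, abs_mul]
      have : κ * g x ^ 2 + 1 / (4 * κ) * w x ^ 2 - |g x| * |w x| =
          κ * (|g x| - |w x| / (2 * κ)) ^ 2 := by
        rw [← sq_abs (g x), ← sq_abs (w x)]
        field_simp
        ring
      nlinarith [mul_nonneg hκ0.le (sq_nonneg (|g x| - |w x| / (2 * κ)))]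
    · rw [integral_add (hg2.const_mul _) ((integrable_testFunction_sq w).const_mul _),
        integral_const_mul, integral_const_mul]
      gcongr
      rw [hκ, div_mul_eq_mul_div, div_le_div_iff₀ (by positivity) (by norm_num)]
      nlinarith
  have h3 : |T w| ≤ |sobolevInner φ w| + |sobolevInner φ w - T w| := by
    have := abs_sub (sobolevInner φ w) (sobolevInner φ w - T w)
    simpa using this
  linarith

/-- **Rellich's theorem**: the unit ball of `H¹₀(Ω)` is totally bounded in `L²`. -/
theorem exists_finite_l2_net (hΩ : Bornology.IsBounded (Ω : Set (Space d))) {η : ℝ} (hη : 0 < η) :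
    ∃ F : Set 𝓓(Ω, ℝ), F.Finite ∧ (∀ ψ ∈ F, sobolevNorm ψ ≤ 1) ∧
      ∀ φ : 𝓓(Ω, ℝ), sobolevNorm φ ≤ 1 → ∃ ψ ∈ F, ∫ x, (φ - ψ) x ^ 2 ≤ η := by
  set V := volume.real (Ω : Set (Space d)) with hV
  have hV0 : 0 ≤ V := measureReal_nonneg
  -- Differences of elements of the unit ball have Dirichlet integral at most `4`. With this `h` the
  -- mollification error contributes `2 * (h² * 4) = η / 2`; the choice of `κ` and of the net radii
  -- gives at most `η / 2` for the rest.
  obtain ⟨P, hP, hPh, c, hc, hPc⟩ := exists_mollifier d (h := √η / 4) (by positivity)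
  set κ := η / (8 * (V + 1)) with hκ
  have hκ0 : 0 < κ := by positivity
  obtain ⟨N, -, hNfin, hN⟩ := Metric.finite_approx_of_totallyBounded
    (hΩ.isCompact_closure.totallyBounded.subset subset_closure) √(κ / (8 * c)) (by positivity)
  have := hNfin.fintype
  -- Sampling the mollification at the net reduces the problem to a bounded set in a
  -- finite-dimensional space, which is totally bounded.
  let Φ : 𝓓(Ω, ℝ) → N → ℝ := fun φ y => mollify P φ y
  have hb : ∀ φ : 𝓓(Ω, ℝ), sobolevNorm φ ≤ 1 → (∫ x, φ x ^ 2) ≤ 1 := fun φ hφ => by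
    have h1 := sobolevNorm_sq φ
    have h2 : sobolevNorm φ ^ 2 ≤ 1 := pow_le_one₀ (sobolevNorm_nonneg _) hφ
    have h3 : 0 ≤ ∫ x, ‖fderiv ℝ φ x‖ ^ 2 := integral_nonneg fun _ => sq_nonneg _
    linarith
  have hΦ : Bornology.IsBounded (Φ '' {φ | sobolevNorm φ ≤ 1}) := by
    refine (Metric.isBounded_closedBall (x := (0 : N → ℝ)) (r := √c)).subset ?_
    rintro _ ⟨φ, hφ, rfl⟩
    rw [mem_closedBall_zero_iff, pi_norm_le_iff_of_nonneg (Real.sqrt_nonneg _)]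
    intro y
    refine Real.le_sqrt_of_sq_le ?_
    have h1 := enorm_mollify_sq_le P φ.continuous hPc y
    rw [lintegral_enorm_sq_eq φ.continuous φ.hasCompactSupport, ← ENNReal.ofReal_mul hc.le,
      ← ofReal_norm, ← ENNReal.ofReal_pow (norm_nonneg _)] at h1
    simp only [Real.norm_eq_abs, sq_abs] at h1
    have h2 := hb φ hφ
    have h3 : 0 ≤ ∫ x, φ x ^ 2 := integral_nonneg fun _ => sq_nonneg _
    have h4 := (ENNReal.ofReal_le_ofReal_iff (by positivity)).1 h1
    rw [Real.norm_eq_abs, sq_abs]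
    exact h4.trans (mul_le_of_le_one_right hc.le h2)
  obtain ⟨t, ht, htfin, htc⟩ := Metric.finite_approx_of_totallyBounded
    (hΦ.isCompact_closure.totallyBounded.subset subset_closure) √(κ / 2) (by positivity)
  have ht' : ∀ v ∈ t, ∃ φ : 𝓓(Ω, ℝ), sobolevNorm φ ≤ 1 ∧ Φ φ = v := fun v hv => ht hv
  choose! f hf hfΦ using ht'
  refine ⟨f '' t, htfin.image f, ?_, fun φ hφ => ?_⟩
  · rintro _ ⟨v, hv, rfl⟩
    exact hf v hv
  · obtain ⟨v, hv, hvφ⟩ := mem_iUnion₂.1 (htc (mem_image_of_mem Φ hφ))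
    refine ⟨f v, mem_image_of_mem f hv, ?_⟩
    have hG : ∫ x, ‖fderiv ℝ (φ - f v : 𝓓(Ω, ℝ)) x‖ ^ 2 ≤ 4 := by
      have h1 := sobolevNorm_sq (φ - f v)
      have h2 := sobolevNorm_sub_le φ (f v) hφ (hf v hv)
      have h3 : 0 ≤ ∫ x, (φ - f v) x ^ 2 := integral_nonneg fun _ => sq_nonneg _
      nlinarith [sobolevNorm_nonneg (φ - f v)]
    have h1 := integral_sq_le_of_mollify_le (G := 4) (θ := √(κ / 2)) (ρ := √(κ / (8 * c)))
      Ω.isOpen hΩ P (by positivity) hc.le (by positivity) (by positivity) (by norm_num) hPh hPc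
      (N := N) (fun x hx => by
        obtain ⟨y, hy, hxy⟩ := mem_iUnion₂.1 (hN hx)
        exact ⟨y, hy, by rw [← dist_eq_norm]; exact hxy.le⟩)
      (testFunction_contDiff (φ - f v) 1) (φ - f v).hasCompactSupport (φ - f v).tsupport_subset hG
      (fun y hy => by
        have h2 : mollify P (φ - f v : 𝓓(Ω, ℝ)) y = mollify P φ y - mollify P (f v) y :=
          mollify_sub P φ.continuous φ.hasCompactSupport (f v).continuous
            (f v).hasCompactSupport y
        have h3 : dist (Φ φ) (Φ (f v)) < √(κ / 2) := by rw [hfΦ v hv]; exact hvφ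
        have h4 := (dist_le_pi_dist (Φ φ) (Φ (f v)) ⟨y, hy⟩).trans h3.le
        rw [h2]
        exact h4)
    refine h1.trans ?_
    rw [div_pow, Real.sq_sqrt hη.le, Real.sq_sqrt (by positivity), Real.sq_sqrt (by positivity)]
    have h2 : c * (κ / (8 * c) * 4) = κ / 2 := by field_simp; norm_num
    rw [h2]
    have h3 : κ * V ≤ η / 8 := by
      rw [hκ, div_mul_eq_mul_div, div_le_div_iff₀ (by positivity) (by norm_num)]
      nlinarith
    rw [← hV]
    nlinarith

/-- The test function `√(φ² + δ²) - δ`, a smooth approximation of `|φ|`. -/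
def smoothAbs (δ : ℝ) (hδ : 0 < δ) (φ : 𝓓(Ω, ℝ)) : 𝓓(Ω, ℝ) where
  toFun x := √(φ x ^ 2 + δ ^ 2) - δ
  contDiff' := ((φ.contDiff.pow 2).add contDiff_const).sqrt (fun x => by positivity)
    |>.sub contDiff_const
  hasCompactSupport' := HasCompactSupport.intro φ.hasCompactSupport fun x hx => by
    rw [image_eq_zero_of_notMem_tsupport hx]; simp [Real.sqrt_sq hδ.le]
  tsupport_subset' := (closure_mono fun x hx => by
    rw [Function.mem_support] at hx ⊢
    contrapose! hx
    simp [hx, Real.sqrt_sq hδ.le]).trans φ.tsupport_subset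

variable {δ : ℝ} (hδ : 0 < δ) (φ : 𝓓(Ω, ℝ))

theorem smoothAbs_apply (x : Space d) : smoothAbs δ hδ φ x = √(φ x ^ 2 + δ ^ 2) - δ := rfl

theorem smoothAbs_nonneg (x : Space d) : 0 ≤ smoothAbs δ hδ φ x := by
  rw [smoothAbs_apply, sub_nonneg]
  exact Real.le_sqrt_of_sq_le (by nlinarith [sq_nonneg (φ x)])

theorem smoothAbs_le (x : Space d) : smoothAbs δ hδ φ x ≤ |φ x| := by
  rw [smoothAbs_apply, sub_le_iff_le_add]
  refine Real.sqrt_le_iff.2 ⟨by positivity, ?_⟩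
  nlinarith [sq_abs (φ x), mul_nonneg (abs_nonneg (φ x)) hδ.le]

theorem abs_le_smoothAbs_add (x : Space d) : |φ x| ≤ smoothAbs δ hδ φ x + δ := by
  rw [smoothAbs_apply, sub_add_cancel]
  exact Real.le_sqrt_of_sq_le (by nlinarith [sq_abs (φ x), sq_nonneg δ])

/-- The chain rule multiplies the derivative by `φ / √(φ² + δ²)`, of modulus at most `1`. Hence
smoothing `|φ|` this way does not leave the unit ball of `H¹₀`, uniformly in `δ`. -/
theorem norm_fderiv_smoothAbs_le (x : Space d) :
    ‖fderiv ℝ (smoothAbs δ hδ φ) x‖ ≤ ‖fderiv ℝ φ x‖ := by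
  have h1 := ((testFunction_contDiff φ 1).differentiable (by norm_num) x).hasFDerivAt
  have hpos : 0 < φ x ^ 2 + δ ^ 2 := by positivity
  have h2 := (((h1.pow 2).add_const (δ ^ 2)).sqrt hpos.ne').sub_const δ
  have h3 : fderiv ℝ (smoothAbs δ hδ φ) x = (φ x / √(φ x ^ 2 + δ ^ 2)) • fderiv ℝ φ x := by
    refine h2.fderiv.trans ?_
    ext v
    simp
    field_simp
  rw [h3, norm_smul]
  refine mul_le_of_le_one_left (norm_nonneg _) ?_
  rw [Real.norm_eq_abs, abs_div, abs_of_pos (Real.sqrt_pos.2 hpos), div_le_one (Real.sqrt_pos.2 hpos)]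
  exact Real.le_sqrt_of_sq_le (by nlinarith [sq_abs (φ x), sq_nonneg δ])

theorem integral_smoothAbs_sq_le : ∫ x, smoothAbs δ hδ φ x ^ 2 ≤ ∫ x, φ x ^ 2 :=
  integral_mono (integrable_testFunction_sq _) (integrable_testFunction_sq _) fun x => by
    simp only
    rw [← sq_abs (φ x)]
    have := smoothAbs_nonneg hδ φ x
    have := smoothAbs_le hδ φ x
    gcongr

theorem sobolevNorm_smoothAbs_le : sobolevNorm (smoothAbs δ hδ φ) ≤ sobolevNorm φ :=
  Real.sqrt_le_sqrt (add_le_add (integral_smoothAbs_sq_le hδ φ)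
    (integral_mono (integrable_norm_fderiv_testFunction_sq _)
      (integrable_norm_fderiv_testFunction_sq _) fun x => by
        have := norm_fderiv_smoothAbs_le hδ φ x
        simp only
        gcongr))

end TestFunctions

/-! ### Domination in `H⁻¹` -/

section Dual

variable {d : ℕ} {Ω : TopologicalSpace.Opens (Space d)}

theorem ofReal_abs_le_hMinusOneNorm (T : 𝓓(Ω, ℝ) → ℝ) {φ : 𝓓(Ω, ℝ)} (hφ : sobolevNorm φ ≤ 1) :
    ENNReal.ofReal |T φ| ≤ hMinusOneNorm T :=
  le_iSup₂_of_le φ hφ le_rfl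

theorem hMinusOneNorm_le {T : 𝓓(Ω, ℝ) → ℝ} {N : ℝ} (h : ∀ φ, sobolevNorm φ ≤ 1 → |T φ| ≤ N) :
    hMinusOneNorm T ≤ ENNReal.ofReal N :=
  iSup₂_le fun φ hφ => ENNReal.ofReal_le_ofReal (h φ hφ)

theorem abs_le_of_hMinusOneNorm_le {T : 𝓓(Ω, ℝ) → ℝ} {N : ℝ} (hN : 0 ≤ N)
    (h : hMinusOneNorm T ≤ ENNReal.ofReal N) {φ : 𝓓(Ω, ℝ)} (hφ : sobolevNorm φ ≤ 1) :
    |T φ| ≤ N :=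
  (ENNReal.ofReal_le_ofReal_iff hN).1 ((ofReal_abs_le_hMinusOneNorm T hφ).trans h)

/-- If the functionals `m i` are dominated by functionals `f i` that converge in `H⁻¹(Ω)`, and
converge as distributions, then they converge in `H⁻¹(Ω)`. -/
theorem tendsto_hMinusOneNorm_of_dominated (hΩ : Bornology.IsBounded (Ω : Set (Space d)))
    {ι : Type*} {l : Filter ι} [l.NeBot] {m : ι → 𝓓(Ω, ℝ) → ℝ} {f : ι → 𝓓(Ω, ℝ) → ℝ}
    {μ ν : 𝓓(Ω, ℝ) →ₗ[ℝ] ℝ} {C B : ℝ} (hC : 0 ≤ C) (hB : 0 ≤ B)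
    (hdom : ∀ᶠ i in l, ∀ (δ : ℝ) (hδ : 0 < δ) (φ : 𝓓(Ω, ℝ)),
      |m i φ| ≤ C * (f i (smoothAbs δ hδ φ) + δ * B))
    (hsub : ∀ᶠ i in l, ∀ φ ψ, m i (φ - ψ) = m i φ - m i ψ)
    (hsmul : ∀ᶠ i in l, ∀ (t : ℝ) φ, m i (t • φ) = t * m i φ)
    (hν : hMinusOneNorm ν < ⊤)
    (hf : Tendsto (fun i => hMinusOneNorm fun φ => f i φ - ν φ) l (𝓝 0))
    (hm : ∀ φ, Tendsto (fun i => m i φ) l (𝓝 (μ φ))) :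
    hMinusOneNorm μ < ⊤ ∧
      Tendsto (fun i => hMinusOneNorm fun φ => m i φ - μ φ) l (𝓝 0) := by
  set N := (hMinusOneNorm ν).toReal with hN
  have hνN : ∀ φ, sobolevNorm φ ≤ 1 → |ν φ| ≤ N := fun φ hφ =>
    abs_le_of_hMinusOneNorm_le ENNReal.toReal_nonneg (by rw [ENNReal.ofReal_toReal hν.ne]) hφ
  have hfτ : ∀ τ : ℝ, 0 < τ → ∀ᶠ i in l, ∀ φ, sobolevNorm φ ≤ 1 → |f i φ - ν φ| ≤ τ :=
    fun τ hτ => by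
      filter_upwards [ENNReal.tendsto_nhds_zero.1 hf _ (ENNReal.ofReal_pos.2 hτ)] with i hi φ hφ
      exact abs_le_of_hMinusOneNorm_le (T := fun φ => f i φ - ν φ) hτ.le hi hφ
  constructor
  · refine (hMinusOneNorm_le (N := C * (N + 1 + 1 * B)) fun φ hφ => ?_).trans_lt
      ENNReal.ofReal_lt_top
    refine le_of_tendsto (hm φ).abs ?_
    filter_upwards [hdom, hfτ 1 one_pos] with i h1 h2
    refine (h1 1 one_pos φ).trans ?_
    have hS := (sobolevNorm_smoothAbs_le one_pos φ).trans hφ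
    have h3 := abs_le.1 (h2 _ hS)
    have h4 := abs_le.1 (hνN _ hS)
    gcongr
    linarith
  · refine ENNReal.tendsto_nhds_zero.2 fun e he => ?_
    obtain ⟨η, hη, hηe⟩ : ∃ η : ℝ, 0 < η ∧ ENNReal.ofReal η ≤ e := by
      obtain ⟨r, hr0, hre⟩ := ENNReal.lt_iff_exists_nnreal_btwn.1 he
      exact ⟨r, by exact_mod_cast hr0, by rw [ENNReal.ofReal_coe_nnreal]; exact hre.le⟩
    -- Four errors of size `κ` occur below: the distance from `f i` to `ν`, the two terms in the
    -- `L²` bound for `ν`, and the smoothing term `δ B`. Multiplied by `C`, they total at most `η /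
    -- 6`.
    set κ := η / (24 * (C + 1)) with hκ
    have hκ0 : 0 < κ := by positivity
    have hκC : C * (4 * κ) ≤ η / 6 := by
      rw [hκ, mul_div_assoc', mul_div_assoc', div_le_div_iff₀ (by positivity) (by norm_num)]
      nlinarith
    obtain ⟨C', hC', hνC⟩ := exists_abs_le_add_mul_integral_sq ν hνN hκ0
    obtain ⟨F, hFfin, hF1, hF⟩ := exists_finite_l2_net hΩ (η := κ / (C' + 1)) (by positivity)
    have hsmall : ∀ᶠ i in l, ∀ u : 𝓓(Ω, ℝ), sobolevNorm u ≤ 1 →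
        ∫ x, u x ^ 2 ≤ κ / (C' + 1) → |m i u| ≤ η / 6 := by
      filter_upwards [hdom, hfτ κ hκ0] with i h1 h2 u hu hu2
      have hδ : 0 < κ / (B + 1) := by positivity
      refine (h1 _ hδ u).trans ((mul_le_mul_of_nonneg_left ?_ hC).trans hκC)
      have hS := (sobolevNorm_smoothAbs_le hδ u).trans hu
      have h3 := abs_le.1 (h2 _ hS)
      have h4 := abs_le.1 (hνC _ hS)
      have h5 : C' * (∫ x, smoothAbs _ hδ u x ^ 2) ≤ κ := by
        calc C' * (∫ x, smoothAbs _ hδ u x ^ 2) ≤ C' * (κ / (C' + 1)) := by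
              gcongr
              exact (integral_smoothAbs_sq_le hδ u).trans hu2
          _ ≤ κ := by
              rw [mul_div_assoc', div_le_iff₀ (by positivity)]
              nlinarith
      have h6 : κ / (B + 1) * B ≤ κ := by
        rw [div_mul_eq_mul_div, div_le_iff₀ (by positivity)]
        nlinarith
      linarith
    have hsmall2 : ∀ᶠ i in l, ∀ φ ψ : 𝓓(Ω, ℝ), sobolevNorm φ ≤ 1 → sobolevNorm ψ ≤ 1 →
        ∫ x, (φ - ψ) x ^ 2 ≤ κ / (C' + 1) → |m i φ - m i ψ| ≤ η / 3 := by
      filter_upwards [hsmall, hsub, hsmul] with i h1 h2 h3 φ ψ hφ hψ hφψ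
      have h4 := sobolevNorm_sub_le φ ψ hφ hψ
      -- The difference of two elements of the unit ball has norm at most `2`; halving it allows
      -- `hsmall` to be used and turns `η / 6` into `η / 3`.
      have h5 := h1 ((1 / 2 : ℝ) • (φ - ψ)) (by
        rw [sobolevNorm_smul, abs_of_pos (by norm_num)]; linarith) (by
        have : ∀ x, ((1 / 2 : ℝ) • (φ - ψ)) x ^ 2 = 1 / 4 * (φ - ψ) x ^ 2 := fun x => by
          rw [show ((1 / 2 : ℝ) • (φ - ψ)) x = 1 / 2 * (φ - ψ) x from rfl]; ring
        simp only [this]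
        rw [integral_const_mul]
        have h0 : 0 ≤ ∫ x, (φ - ψ) x ^ 2 := integral_nonneg fun _ => sq_nonneg _
        linarith)
      rw [h3, h2, abs_mul, abs_of_pos (by norm_num : (0 : ℝ) < 1 / 2)] at h5
      linarith
    have hFε : ∀ᶠ i in l, ∀ ψ ∈ F, |m i ψ - μ ψ| ≤ η / 3 :=
      (eventually_all_finite hFfin).2 fun ψ _ => by
        filter_upwards [(Metric.tendsto_nhds.1 (hm ψ)) (η / 3) (by positivity)] with i hi
        exact hi.le
    filter_upwards [hsmall2, hFε] with i h1 h2
    refine (hMinusOneNorm_le fun φ hφ => ?_).trans hηe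
    obtain ⟨ψ, hψF, hψ⟩ := hF φ hφ
    have h3 := h1 φ ψ hφ (hF1 ψ hψF) hψ
    have h4 := h2 ψ hψF
    -- The asymptotic equicontinuity passes to the distributional limit.
    have h5 : |μ φ - μ ψ| ≤ η / 3 := by
      refine le_of_tendsto ((hm φ).sub (hm ψ)).abs ?_
      filter_upwards [hsmall2] with k hk using hk φ ψ hφ (hF1 ψ hψF) hψ
    rw [abs_le] at h3 h4 h5 ⊢
    constructor <;> linarith [h3.1, h3.2, h4.1, h4.2, h5.1, h5.2]

end Dual

/-! ### Densities of perforations -/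

section Density

variable {d : ℕ} {Ω : TopologicalSpace.Opens (Space d)}

theorem exists_probability_setAverage {A : Set (Space d)} (hA : NullMeasurableSet A volume)
    (h0 : volume A ≠ 0) (ht : volume A ≠ ⊤) :
    ∃ Q : Measure (Space d), IsProbabilityMeasure Q ∧ (∀ᵐ x ∂Q, x ∈ A) ∧
      ∀ f : Space d → ℝ, ⨍ x in A, f x = ∫ x, f x ∂Q := by
  have h1 : IsFiniteMeasure (volume.restrict A) := ⟨by simpa using ht.lt_top⟩
  have h2 : NeZero (volume.restrict A) := ⟨by rwa [Ne, Measure.restrict_eq_zero]⟩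
  exact ⟨(volume.restrict A univ)⁻¹ • volume.restrict A, inferInstance,
    Measure.ae_smul_measure (ae_restrict_mem₀ hA) _, fun f => rfl⟩

theorem integrable_testFunction_of_isFiniteMeasure (Q : Measure (Space d)) [IsFiniteMeasure Q]
    (φ : 𝓓(Ω, ℝ)) : Integrable φ Q := by
  obtain ⟨M, hM⟩ := φ.continuous.bounded_above_of_compact_support φ.hasCompactSupport
  exact Integrable.of_bound φ.continuous.aestronglyMeasurable M (Eventually.of_forall hM)

/-- The pointwise bound `|φ| ≤ smoothAbs δ hδ φ + δ`, averaged. Over a null set the averages take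
the default value `0`. -/
theorem abs_setAverage_le {A : Set (Space d)} (hA : NullMeasurableSet A volume)
    (ht : volume A ≠ ⊤) (φ : 𝓓(Ω, ℝ)) {δ : ℝ} (hδ : 0 < δ) :
    |⨍ x in A, φ x| ≤ (⨍ x in A, smoothAbs δ hδ φ x) + δ := by
  rcases eq_or_ne (volume A) 0 with h0 | h0
  · simp [Measure.restrict_eq_zero.2 h0, hδ.le]
  · obtain ⟨Q, hQ, -, hQA⟩ := exists_probability_setAverage hA h0 ht
    rw [hQA, hQA, ← Real.norm_eq_abs]
    have hi := integrable_testFunction_of_isFiniteMeasure Q (smoothAbs δ hδ φ)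
    refine (norm_integral_le_of_norm_le (hi.add (integrable_const δ))
      (Eventually.of_forall fun x => abs_le_smoothAbs_add hδ φ x)).trans_eq ?_
    rw [integral_add' hi (integrable_const δ)]
    simp

theorem abs_setAverage_sub_le {A : Set (Space d)} (hA : NullMeasurableSet A volume)
    (h0 : volume A ≠ 0) (ht : volume A ≠ ⊤) (φ : 𝓓(Ω, ℝ)) {p r : ℝ}
    (h : ∀ x ∈ A, |φ x - p| ≤ r) : |(⨍ x in A, φ x) - p| ≤ r := by
  obtain ⟨Q, hQ, hQm, hQA⟩ := exists_probability_setAverage hA h0 ht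
  have hi := integrable_testFunction_of_isFiniteMeasure Q φ
  have h1 : (∫ x, φ x ∂Q) - p = ∫ x, (φ x - p) ∂Q := by
    rw [integral_sub hi (integrable_const p)]; simp
  rw [hQA, h1, ← Real.norm_eq_abs]
  refine (norm_integral_le_of_norm_le (integrable_const r) (hQm.mono fun x hx => h x hx)).trans_eq ?_
  simp

variable {I : Type*} [Countable I] {b c : I → ℝ} {A : I → Set (Space d)}

/-- Each term has `L¹` norm at most `c i * sup |φ|`, so sum and integral may be exchanged. The sets
may overlap; only the summability of the weights matters. -/
theorem hasSum_pairing_density (hc : ∀ i, 0 ≤ c i) (hs : Summable c)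
    (hA : ∀ i, NullMeasurableSet (A i) volume) (ht : ∀ i, volume (A i) ≠ ⊤) (φ : 𝓓(Ω, ℝ)) :
    HasSum (fun i => c i * ⨍ x in A i, φ x) (pairing Ω (density c A) φ) := by
  obtain ⟨M, hM⟩ := φ.continuous.bounded_above_of_compact_support φ.hasCompactSupport
  have hφ : Integrable φ := φ.continuous.integrable_of_hasCompactSupport φ.hasCompactSupport
  let F : I → Space d → ℝ := fun i x => (A i).indicator (fun _ => c i / volume.real (A i)) x * φ x
  have hF : ∀ i, F i = (A i).indicator fun x => c i / volume.real (A i) * φ x := fun i => by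
    funext x
    by_cases hx : x ∈ A i <;> simp [F, hx]
  have hFi : ∀ i, Integrable (F i) := fun i => by
    rw [hF]; exact (hφ.const_mul _).indicator₀ (hA i)
  have hFint : ∀ i, ∫ x, F i x = c i * ⨍ x in A i, φ x := fun i => by
    rw [hF, integral_indicator₀ (hA i), integral_const_mul, setAverage_eq, smul_eq_mul]
    ring
  have hFn : ∀ i, ∫ x, ‖F i x‖ ≤ c i * M := fun i => by
    have h1 : ∀ x, ‖F i x‖ = (A i).indicator (fun x => c i / volume.real (A i) * ‖φ x‖) x := by
      intro x
      rw [hF, norm_indicator_eq_indicator_norm]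
      congr 1
      funext y
      rw [norm_mul, Real.norm_of_nonneg (div_nonneg (hc i) measureReal_nonneg)]
    simp only [h1]
    rw [integral_indicator₀ (hA i), integral_const_mul]
    have h2 : ∫ x in A i, ‖φ x‖ ≤ M * volume.real (A i) := by
      have := norm_setIntegral_le_of_norm_le_const (μ := volume) (s := A i) (f := fun x => ‖φ x‖)
        (C := M) (ht i).lt_top (fun x _ => by rw [norm_norm]; exact hM x)
      exact (le_abs_self _).trans this
    have hM0 : 0 ≤ M := (norm_nonneg _).trans (hM 0)
    calc c i / volume.real (A i) * ∫ x in A i, ‖φ x‖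
        ≤ c i / volume.real (A i) * (M * volume.real (A i)) :=
          mul_le_mul_of_nonneg_left h2 (div_nonneg (hc i) measureReal_nonneg)
      _ = (volume.real (A i) / volume.real (A i)) * (c i * M) := by ring
      -- An inequality and not an equality, because the quotient is `0 / 0 = 0` for a null set.
      _ ≤ 1 * (c i * M) := by
          have := mul_nonneg (hc i) hM0
          gcongr
          exact div_self_le_one _
      _ = c i * M := one_mul _
  have hsum : Summable fun i => ∫ x, ‖F i x‖ :=
    Summable.of_nonneg_of_le (fun i => integral_nonneg fun _ => norm_nonneg _) hFn (hs.mul_right M)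
  have key := hasSum_integral_of_summable_integral_norm hFi hsum
  have hp : ∫ x, ∑' i, F i x = pairing Ω (density c A) φ :=
    integral_congr_ae (Eventually.of_forall fun x => tsum_mul_right)
  rw [hp] at key
  simpa only [hFint] using key

theorem pairing_density_sub (hc : ∀ i, 0 ≤ c i) (hs : Summable c)
    (hA : ∀ i, NullMeasurableSet (A i) volume) (ht : ∀ i, volume (A i) ≠ ⊤) (φ ψ : 𝓓(Ω, ℝ)) :
    pairing Ω (density c A) (φ - ψ) = pairing Ω (density c A) φ - pairing Ω (density c A) ψ := by
  have h := (hasSum_pairing_density hc hs hA ht φ).sub (hasSum_pairing_density hc hs hA ht ψ)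
  have hi : ∀ (i : I) (χ : 𝓓(Ω, ℝ)), IntegrableOn χ (A i) := fun i χ =>
    (χ.continuous.integrable_of_hasCompactSupport χ.hasCompactSupport).integrableOn
  have e : ∀ i, c i * (⨍ x in A i, φ x) - c i * (⨍ x in A i, ψ x) =
      c i * ⨍ x in A i, (φ - ψ) x := fun i => by
    rw [← mul_sub, setAverage_eq, setAverage_eq, setAverage_eq, ← smul_sub,
      ← integral_sub (hi i φ) (hi i ψ)]
    rfl
  simp only [e] at h
  exact (hasSum_pairing_density hc hs hA ht (φ - ψ)).unique h

theorem pairing_smul (f : Space d → ℝ) (t : ℝ) (φ : 𝓓(Ω, ℝ)) :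
    pairing Ω f (t • φ) = t * pairing Ω f φ := by
  rw [pairing, pairing, ← integral_const_mul]
  refine integral_congr_ae (Eventually.of_forall fun x => ?_)
  show f x * (t * φ x) = t * (f x * φ x)
  ring

/-- This supplies the domination hypothesis of `tendsto_hMinusOneNorm_of_dominated`: the weights are
compared term by term, with `δ` paid once per unit of mass. -/
theorem abs_pairing_density_le {C : ℝ} (hc : ∀ i, 0 ≤ c i) (hb : ∀ i, 0 ≤ b i)
    (hcb : ∀ i, c i ≤ C * b i) (hs : Summable b)
    (hA : ∀ i, NullMeasurableSet (A i) volume) (ht : ∀ i, volume (A i) ≠ ⊤) {δ : ℝ} (hδ : 0 < δ)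
    (φ : 𝓓(Ω, ℝ)) :
    |pairing Ω (density c A) φ| ≤
      C * (pairing Ω (density b A) (smoothAbs δ hδ φ) + δ * ∑' i, b i) := by
  have hsc : Summable c := Summable.of_nonneg_of_le hc hcb (hs.mul_left C)
  have h1 := hasSum_pairing_density hc hsc hA ht φ
  have h2 := ((hasSum_pairing_density hb hs hA ht (smoothAbs δ hδ φ)).add
    (hs.hasSum.mul_left δ)).mul_left C
  rw [← h1.tsum_eq, ← Real.norm_eq_abs]
  refine tsum_of_norm_bounded h2 fun i => ?_
  rw [Real.norm_eq_abs, abs_mul, abs_of_nonneg (hc i)]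
  have h3 := abs_setAverage_le (hA i) (ht i) φ hδ
  calc c i * |⨍ x in A i, φ x| ≤ c i * ((⨍ x in A i, smoothAbs δ hδ φ x) + δ) :=
        mul_le_mul_of_nonneg_left h3 (hc i)
    _ ≤ C * b i * ((⨍ x in A i, smoothAbs δ hδ φ x) + δ) :=
        mul_le_mul_of_nonneg_right (hcb i) ((abs_nonneg _).trans h3)
    _ = _ := by ring

/-- Both averages differ from the value of `φ` at a point of `K i` by at most `L` times the diameter
of `A i`. -/
theorem abs_pairing_density_sub_le {C : ℝ} (hc : ∀ i, 0 ≤ c i) (hb : ∀ i, 0 ≤ b i)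
    (hcb : ∀ i, c i ≤ C * b i) (hs : Summable b)
    (hA : ∀ i, NullMeasurableSet (A i) volume) (ht : ∀ i, volume (A i) ≠ ⊤)
    {K : I → Set (Space d)} (hK : ∀ i, NullMeasurableSet (K i) volume) (hKA : ∀ i, K i ⊆ A i)
    (hK0 : ∀ i, volume (K i) ≠ 0)
    (hD : ∑' i, ENNReal.ofReal (b i) * Metric.ediam (A i) ≠ ⊤)
    {φ : 𝓓(Ω, ℝ)} {L : NNReal} (hL : LipschitzWith L φ) :
    |pairing Ω (density c A) φ - pairing Ω (density c K) φ| ≤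
      C * (2 * L) * (∑' i, ENNReal.ofReal (b i) * Metric.ediam (A i)).toReal := by
  have hsc : Summable c := Summable.of_nonneg_of_le hc hcb (hs.mul_left C)
  have hKt : ∀ i, volume (K i) ≠ ⊤ := fun i => ne_top_of_le_ne_top (ht i) (measure_mono (hKA i))
  have h1 := (hasSum_pairing_density hc hsc hA ht φ).sub (hasSum_pairing_density hc hsc hK hKt φ)
  have hDi := ENNReal.ne_top_of_tsum_ne_top hD
  have h2 := (ENNReal.summable_toReal hD).hasSum.mul_left (C * (2 * L))
  rw [← ENNReal.tsum_toReal_eq hDi] at h2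
  rw [← h1.tsum_eq, ← Real.norm_eq_abs]
  refine tsum_of_norm_bounded h2 fun i => ?_
  rw [← mul_sub, Real.norm_eq_abs, abs_mul, abs_of_nonneg (hc i), ENNReal.toReal_mul,
    ENNReal.toReal_ofReal (hb i)]
  -- A tile of infinite diameter is compatible with a finite sum only if its weight is zero, since
  -- `0 * ∞ = 0`; then `c i` vanishes as well.
  rcases (hb i).eq_or_lt with hbi | hbi
  · have : c i = 0 := le_antisymm (by simpa [← hbi] using hcb i) (hc i)
    simp [this, ← hbi]
  have hdiam : Metric.ediam (A i) ≠ ⊤ := fun h => hDi i (by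
    rw [h, ENNReal.mul_top (ENNReal.ofReal_pos.2 hbi).ne'])
  set r := (Metric.ediam (A i)).toReal with hr
  obtain ⟨p, hp⟩ := nonempty_of_measure_ne_zero (hK0 i)
  have hosc : ∀ x ∈ A i, |φ x - φ p| ≤ L * r := fun x hx => by
    rw [← Real.dist_eq]
    refine (hL.dist_le_mul x p).trans ?_
    gcongr
    rw [dist_edist]
    exact ENNReal.toReal_mono hdiam (Metric.edist_le_ediam_of_mem hx (hKA i hp))
  have hA0 : volume (A i) ≠ 0 := fun h => hK0 i (measure_mono_null (hKA i) h)
  have h3 := abs_setAverage_sub_le (hA i) hA0 (ht i) φ hosc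
  have h4 := abs_setAverage_sub_le (hK i) (hK0 i) (hKt i) φ fun x hx => hosc x (hKA i hx)
  have h5 : |(⨍ x in A i, φ x) - ⨍ x in K i, φ x| ≤ 2 * L * r := by
    rw [abs_le] at h3 h4 ⊢
    constructor <;> linarith [h3.1, h3.2, h4.1, h4.2]
  calc c i * |(⨍ x in A i, φ x) - ⨍ x in K i, φ x| ≤ c i * (2 * L * r) :=
        mul_le_mul_of_nonneg_left h5 (hc i)
    _ ≤ C * b i * (2 * L * r) := mul_le_mul_of_nonneg_right (hcb i) (by positivity)
    _ = _ := by ring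

end Density

/-! ### Perforations satisfying the assumptions -/

section Holes

variable {d : ℕ} {Ω : TopologicalSpace.Opens (Space d)} {Λ : ℝ → Type*}
  {K : (ε : ℝ) → Λ ε → Set (Space d)} {x : (ε : ℝ) → Λ ε → Space d}
  {a R : (ε : ℝ) → Λ ε → ℝ} {A : (ε : ℝ) → Λ ε → Set (Space d)} {μ : 𝓓'(Ω, ℝ)}

theorem HoleAssumptions.radius_nonneg (h : HoleAssumptions Ω K x a R A μ) :
    ∀ᶠ ε in 𝓝[>] (0 : ℝ), ∀ i : Active Ω K ε, 0 ≤ a ε i := by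
  filter_upwards [h.minimalBall] with ε h1 i
  obtain ⟨y, -, hy⟩ := i.2
  exact dist_nonneg.trans ((h1 i).1 hy)

theorem HoleAssumptions.subset_tile (h : HoleAssumptions Ω K x a R A μ) :
    ∀ᶠ ε in 𝓝[>] (0 : ℝ), ∀ i : Active Ω K ε, K ε i ⊆ A ε i := by
  obtain ⟨c, hc, hr⟩ := h.ratio_bounded
  filter_upwards [h.minimalBall, h.radius_pos, h.ball_subset_tile, hr] with ε h1 h2 h3 h4 i
  -- Strict inequality puts the closed minimal ball inside the open separating ball, which lies in
  -- the tile.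
  have : a ε i < R ε i := by
    have := (h4 i).trans_lt hc
    rwa [div_lt_one (h2 i)] at this
  exact ((h1 i).1.trans (Metric.closedBall_subset_ball this)).trans (h3 i)

theorem HoleAssumptions.volume_tile_ne_top (h : HoleAssumptions Ω K x a R A μ) :
    ∀ᶠ ε in 𝓝[>] (0 : ℝ), ∀ i : Active Ω K ε, volume (A ε i) ≠ ⊤ := by
  obtain ⟨C, hC⟩ := h.volume_tile
  filter_upwards [hC] with ε h1 i using ne_top_of_le_ne_top ENNReal.ofReal_ne_top (h1 i)

theorem HoleAssumptions.exists_tsum_le (h : HoleAssumptions Ω K x a R A μ) :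
    ∃ B : ℝ, 0 ≤ B ∧ ∀ᶠ ε in 𝓝[>] (0 : ℝ),
      (Summable fun i : Active Ω K ε => a ε i ^ (d - 2)) ∧
        ∑' i : Active Ω K ε, a ε i ^ (d - 2) ≤ B := by
  obtain ⟨C, hC⟩ := h.sum_bounded
  refine ⟨max C 0, le_max_right _ _, ?_⟩
  filter_upwards [hC, h.radius_nonneg] with ε h1 h2
  have h3 : ∀ i : Active Ω K ε, (ENNReal.ofReal (a ε i ^ (d - 2))).toReal = a ε i ^ (d - 2) :=
    fun i => ENNReal.toReal_ofReal (pow_nonneg (h2 i) _)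
  have hne := ne_top_of_le_ne_top ENNReal.ofReal_ne_top h1
  constructor
  · simpa only [h3] using ENNReal.summable_toReal hne
  · have h4 := ENNReal.tsum_toReal_eq (ENNReal.ne_top_of_tsum_ne_top hne)
    simp only [h3] at h4
    rw [← h4]
    exact ENNReal.toReal_le_of_le_ofReal (le_max_right _ _)
      (h1.trans (ENNReal.ofReal_le_ofReal (le_max_left _ _)))

theorem HoleAssumptions.exists_capacity_le (hd : 3 ≤ d) (h : HoleAssumptions Ω K x a R A μ) :
    ∃ C : ℝ, 0 ≤ C ∧ ∀ᶠ ε in 𝓝[>] (0 : ℝ), ∀ i : Active Ω K ε,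
      capacity (K ε i) ≤ C * a ε i ^ (d - 2) := by
  obtain ⟨C, hC0, hC⟩ := Perforated.exists_capacity_le hd
  refine ⟨C, hC0, ?_⟩
  filter_upwards [h.isCompact, h.minimalBall] with ε h1 h2 i
  exact hC _ _ _ (h1 i) (i.2.mono inter_subset_right) (h2 i).1

theorem HoleAssumptions.tendsto_hMinusOneNorm [∀ ε, Countable (Λ ε)] (hd : 3 ≤ d)
    (hΩ : Bornology.IsBounded (Ω : Set (Space d))) (h : HoleAssumptions Ω K x a R A μ) :
    hMinusOneNorm μ < ⊤ ∧
      Tendsto (fun ε => hMinusOneNorm fun φ : 𝓓(Ω, ℝ) =>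
          pairing Ω (density (fun i : Active Ω K ε => capacity (K ε i)) fun i => A ε i) φ - μ φ)
        (𝓝[>] (0 : ℝ)) (𝓝 0) := by
  obtain ⟨C, hC0, hC⟩ := h.exists_capacity_le hd
  obtain ⟨B, hB0, hB⟩ := h.exists_tsum_le
  obtain ⟨ν, hν, hf⟩ := h.converges
  refine tendsto_hMinusOneNorm_of_dominated (μ := μ.toLinearMap) (ν := ν.toLinearMap) hΩ hC0 hB0
    ?_ ?_ (Eventually.of_forall fun ε t φ => pairing_smul _ t φ) hν hf h.limit_density
  · filter_upwards [hC, hB, h.measurable_tile, h.volume_tile_ne_top, h.radius_nonneg]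
      with ε h1 h2 h3 h4 h5 δ hδ φ
    refine (abs_pairing_density_le (fun i => capacity_nonneg _)
      (fun i => pow_nonneg (h5 i) _) h1 h2.1 h3 h4 hδ φ).trans ?_
    have := h2.2
    gcongr
  · filter_upwards [hC, hB, h.measurable_tile, h.volume_tile_ne_top] with ε h1 h2 h3 h4
    exact pairing_density_sub (fun i => capacity_nonneg _)
      (Summable.of_nonneg_of_le (fun i => capacity_nonneg _) h1 (h2.1.mul_left C)) h3 h4

theorem HoleAssumptions.tendsto_pairing_holes [∀ ε, Countable (Λ ε)] (hd : 3 ≤ d)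
    (h : HoleAssumptions Ω K x a R A μ)
    (hK : ∀ᶠ ε in 𝓝[>] (0 : ℝ), ∀ i : Active Ω K ε, 0 < volume (K ε i)) (φ : 𝓓(Ω, ℝ)) :
    Tendsto (fun ε =>
        pairing Ω (density (fun i : Active Ω K ε => capacity (K ε i)) fun i => K ε i) φ)
      (𝓝[>] (0 : ℝ)) (𝓝 (μ φ)) := by
  obtain ⟨C, hC0, hC⟩ := h.exists_capacity_le hd
  obtain ⟨B, hB0, hB⟩ := h.exists_tsum_le
  obtain ⟨L, hL⟩ : ∃ L : NNReal, LipschitzWith L φ :=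
    ContDiff.lipschitzWith_of_hasCompactSupport φ.hasCompactSupport
      (testFunction_contDiff φ 1) (by norm_num)
  have hlim : Tendsto (fun ε => C * (2 * L) * (∑' i : Active Ω K ε,
      ENNReal.ofReal (a ε i ^ (d - 2)) * Metric.ediam (A ε i)).toReal) (𝓝[>] (0 : ℝ)) (𝓝 0) := by
    have := ((ENNReal.tendsto_toReal ENNReal.zero_ne_top).comp h.sum_diam).const_mul (C * (2 * L))
    simpa using this
  have hdiff : Tendsto (fun ε =>
      pairing Ω (density (fun i : Active Ω K ε => capacity (K ε i)) fun i => A ε i) φ -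
      pairing Ω (density (fun i : Active Ω K ε => capacity (K ε i)) fun i => K ε i) φ)
      (𝓝[>] (0 : ℝ)) (𝓝 0) := by
    refine squeeze_zero_norm' ?_ hlim
    filter_upwards [hC, hB, h.measurable_tile, h.volume_tile_ne_top, h.radius_nonneg, hK,
      h.isCompact, h.subset_tile, h.sum_diam.eventually_lt_const ENNReal.zero_lt_top]
      with ε h1 h2 h3 h4 h5 h6 h7 h8 h9
    exact abs_pairing_density_sub_le (fun i => capacity_nonneg _)
      (fun i => pow_nonneg (h5 i) _) h1 h2.1 h3 h4
      (fun i => (h7 i).isClosed.measurableSet.nullMeasurableSet) h8 (fun i => (h6 i).ne')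
      h9.ne hL
  simpa using (h.limit_density φ).sub hdiff

end Holes

end Perforated

end

theorem proposition3p4 {d : ℕ} (hd : 3 ≤ d)
    (Ω : TopologicalSpace.Opens (Perforated.Space d))
    (hΩ : Bornology.IsBounded (Ω : Set (Perforated.Space d)))
    {Λ : ℝ → Type*} [∀ ε, Countable (Λ ε)]
    (K : (ε : ℝ) → Λ ε → Set (Perforated.Space d))
    (x : (ε : ℝ) → Λ ε → Perforated.Space d) (a R : (ε : ℝ) → Λ ε → ℝ)
    (A : (ε : ℝ) → Λ ε → Set (Perforated.Space d)) (μ : 𝓓'(Ω, ℝ))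
    (h : Perforated.HoleAssumptions Ω K x a R A μ) :
    (Perforated.hMinusOneNorm μ < ⊤ ∧
      Tendsto
        (fun ε => Perforated.hMinusOneNorm fun φ : 𝓓(Ω, ℝ) =>
          Perforated.pairing Ω
            (Perforated.density
              (fun i : Perforated.Active Ω K ε => Perforated.capacity (K ε i))
              fun i => A ε i) φ - μ φ)
        (𝓝[>] (0 : ℝ)) (𝓝 0)) ∧
    ((∀ᶠ ε in 𝓝[>] (0 : ℝ), ∀ i : Perforated.Active Ω K ε, 0 < volume (K ε i)) →
      ∀ φ : 𝓓(Ω, ℝ), Tendsto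
        (fun ε => Perforated.pairing Ω
          (Perforated.density
            (fun i : Perforated.Active Ω K ε => Perforated.capacity (K ε i))
            fun i => K ε i) φ)
        (𝓝[>] (0 : ℝ)) (𝓝 (μ φ))) :=
  ⟨h.tendsto_hMinusOneNorm hd hΩ, h.tendsto_pairing_holes hd⟩
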